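/- Let $Q$ be a free abelian group of finite rank with a non-degenerate symmetric bilinear form $(\cdot,\cdot):Q\times Q\to\mathbb{Z}$, let $W=\Pi(\mathbb{C}\otimes_{\mathbb{Z}}Q)$ be its complexification with reversed parity, with the form extended bilinearly, and let $\varepsilon:Q\times Q\to\mathbb{C}^\times$ be a 2-cocycle such that $\varepsilon(\alpha,\beta)=(-1)^{(\alpha,\beta)+(\alpha,\alpha)(\beta,\beta)}\varepsilon(\beta,\alpha)$ for all $\alpha,\beta\in Q$. Let $V_Q^{\mathrm{super}}=V^1(W)\otimes\mathbb{C}_\varepsilon[Q]$ be the associated $N_K=1$ SUSY lattice vertex algebra. Here $V^1(W)$ is the Fock space generated from $|0\rangle$ by the creation operators $h_{(j|J)}$ ($h\in W$, $j<0$, $J\in\{0,1\}$), where $[h_{(m|0)},h'_{(n|0)}]=m(h,h')\delta_{m,-n}$ and $[h_{(m|1)},h'_{(n|1)}]=(h,h')\delta_{m,-n-1}$ are the only non-zero (super)commutators; $\mathbb{C}_\varepsilon[Q]$ is the twisted group algebra, $e^\alpha e^\beta=\varepsilon(\alpha,\beta)e^{\alpha+\beta}$, with $e^\alpha$ of parity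 $(\alpha,\alpha)$ mod $2$; $h_{(0|0)}$ acts on $V^1(W)\otimes e^\beta$ as $(h,\beta)$; the superfield of $h=h_{(-1|1)}|0\rangle$ is $h(z,\theta)=\sum_j z^{-1-j}(h_{(j|1)}+\theta h_{(j|0)})$; the superfield $\Gamma_\alpha$ of $1\otimes e^\alpha$ is $$\Gamma_\alpha(z,\theta)=e^\alpha z^{\alpha_{(0|0)}}\Bigl(1+\theta\sum_{j\in\mathbb{Z}}z^{-1-j}\alpha_{(j|1)}\Bigr)\exp\Bigl(-\sum_{j<0}\tfrac{z^{-j}}{j}\alpha_{(j|0)}\Bigr)\exp\Bigl(-\sum_{j>0}\tfrac{z^{-j}}{j}\alpha_{(j|0)}\Bigr);$$ the odd operator $S$ is determined by $[S,h_{(n|1)}]=h_{(n|0)}$, $[S,h_{(n|0)}]=-n\,h_{(n-1|1)}$ and $S(1\otimes e^\alpha)=\alpha_{(-1|1)}\otimes e^\alpha$, and $T=S^2$. Write $Y(a,z,\theta)=\sum_j z^{-1-j}(a_{(j|1)}+\theta a_{(j|0)})$ for the superfield of a state $a$, $:ab:\;=a_{(-1|1)}b$, and $[a_\Lambda b]=\sum_{j\ge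 0}\frac{\lambda^j}{j!}\bigl(a_{(j|0)}b+\chi\,a_{(j|1)}b\bigr)$, where $\chi^2=-\lambda$. Let $\{\alpha_i\}$ and $\{\alpha^i\}$ be dual bases of $W$, $(\alpha_i,\alpha^j)=\delta_{ij}$, and let $$G=\sum_i :(S\alpha_i)\alpha^i:\;\in V_Q^{\mathrm{super}}.$$ Then $G$ is an $N_K=1$ conformal (Neveu–Schwarz) vector of central charge $c=\tfrac32\operatorname{rank}Q$, that is, $$[G_\Lambda G]=(2T+3\lambda+\chi S)G+\tfrac{c}{3}\lambda^2\chi|0\rangle,\qquad G_{(0|0)}=2T,\qquad G_{(0|1)}=S,$$ and $G_{(1|0)}$ is diagonalizable on $V_Q^{\mathrm{super}}$; if $(\cdot,\cdot)$ is positive definite, then the eigenvalues of $G_{(1|0)}$ are real and bounded below and its eigenspaces are finite-dimensional. Every $h\in W$ is primary of conformal weight $\tfrac12$, i.e. $[G_\Lambda h]=(2T+\lambda+\chi S)h$, and for every $\alpha\in Q$ the superfield $\Gamma_\alpha$ is primary of conformal weight $\tfrac12(\alpha,\alpha)$, i.e. $$[G_\Lambda\Gamma_\alpha]=(2T+(\alpha,\alpha)\lambda+\chi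 S)\Gamma_\alpha .$$ -/

import Mathlib

open scoped TensorProduct

noncomputable section

namespace SUSYLattice

/-! ### Fields on a vector space -/

section Fields

variable {V : Type*} [AddCommGroup V] [Module ℂ V]

open scoped VertexOperator

/-- The field `∑ₙ f n z^(-1-n)`, for modes `f n` that on each vector vanish for large `n`. -/
def ofModes (f : ℤ → Module.End ℂ V) (hf : ∀ v, ∃ N : ℤ, ∀ n, N ≤ n → f n v = 0) :
    VertexOperator ℂ V :=
  VertexOperator.of_coeff (fun k => f (-k - 1)) (by
    intro v
    obtain ⟨N, hN⟩ := hf v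
    refine ⟨-N, fun k hk => ?_⟩
    by_contra h
    exact hk (hN _ (by omega)))

theorem ofModes_ncoeff (f : ℤ → Module.End ℂ V) (hf) (n : ℤ) : (ofModes f hf)[[n]] = f n := by
  rw [ofModes, VertexOperator.ncoeff_of_coeff]
  congr 1
  ring

theorem exists_ncoeff_eq_zero (A : VertexOperator ℂ V) (v : V) :
    ∃ N : ℤ, ∀ n, N ≤ n → (A[[n]]) v = 0 := by
  refine ⟨-HahnSeries.order ((HahnModule.of ℂ).symm (A v)), fun n hn => ?_⟩
  exact VertexOperator.ncoeff_eq_zero_of_lt_order A n v (by omega)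

/-- The derivative `∂_z A(z)`. -/
def fieldDeriv (A : VertexOperator ℂ V) : VertexOperator ℂ V :=
  ofModes (fun n => (-(n : ℂ)) • (A[[n - 1]])) (by
    intro v
    obtain ⟨N, hN⟩ := exists_ncoeff_eq_zero A v
    exact ⟨N + 1, fun n hn => by simp [hN (n - 1) (by omega)]⟩)

theorem finite_support_of_eventually {M : Type*} [Zero M] {f : ℕ → M} (N : ℤ)
    (h : ∀ j : ℕ, N ≤ j → f j = 0) : (Function.support f).Finite := by
  refine (Set.finite_lt_nat N.toNat).subset fun j hj => ?_
  by_contra hlt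
  exact hj (h j (by simp only [Set.mem_ofPred_eq] at hlt; omega))

theorem finite_support_left (A B : VertexOperator ℂ V) (n : ℤ) (v : V) :
    (Function.support fun j : ℕ => (A[[-(j : ℤ) - 1]]) ((B[[n + j]]) v)).Finite := by
  obtain ⟨N, hN⟩ := exists_ncoeff_eq_zero B v
  exact finite_support_of_eventually (N - n) fun j hj => by
    rw [hN _ (by omega), map_zero]

theorem finite_support_right (A B : VertexOperator ℂ V) (n : ℤ) (v : V) :
    (Function.support fun j : ℕ => (B[[n - j - 1]]) ((A[[(j : ℤ)]]) v)).Finite := by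
  obtain ⟨N, hN⟩ := exists_ncoeff_eq_zero A v
  exact finite_support_of_eventually N fun j hj => by
    rw [hN _ hj, map_zero]

/-- The mode `n` of the normally ordered product `:A(z)B(z):`, that is
`∑_{j<0} A_(j) B_(n-j-1) + σ ∑_{j≥0} B_(n-j-1) A_(j)`. -/
def nopMode (σ : ℂ) (A B : VertexOperator ℂ V) (n : ℤ) : Module.End ℂ V where
  toFun v := (∑ᶠ j : ℕ, (A[[-(j : ℤ) - 1]]) ((B[[n + j]]) v)) +
    σ • ∑ᶠ j : ℕ, (B[[n - j - 1]]) ((A[[(j : ℤ)]]) v)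
  map_add' v w := by
    simp only [map_add]
    rw [finsum_add_distrib (finite_support_left A B n v) (finite_support_left A B n w),
      finsum_add_distrib (finite_support_right A B n v) (finite_support_right A B n w), smul_add]
    abel
  map_smul' c v := by
    simp only [map_smul, RingHom.id_apply]
    rw [← smul_finsum, ← smul_finsum, smul_add, smul_comm σ c]

/-- The normally ordered product `:A(z)B(z):` of two fields. Here `σ` is the sign
`(-1)^(p(A)p(B))`. -/
def nop (σ : ℂ) (A B : VertexOperator ℂ V) : VertexOperator ℂ V :=
  ofModes (nopMode σ A B) (by
    intro v
    obtain ⟨N, hN⟩ := exists_ncoeff_eq_zero B v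
    obtain ⟨M, hM⟩ := exists_ncoeff_eq_zero A v
    choose K hK using fun j : ℕ => exists_ncoeff_eq_zero B ((A[[(j : ℤ)]]) v)
    obtain ⟨L, hL⟩ := ((Finset.range M.toNat).image fun j : ℕ => K j + j + 1).bddAbove
    refine ⟨max N L, fun n hn => ?_⟩
    have h1 : ∀ j : ℕ, (A[[-(j : ℤ) - 1]]) ((B[[n + j]]) v) = 0 := fun j => by
      rw [hN _ (by have := le_max_left N L; omega), map_zero]
    have h2 : ∀ j : ℕ, (B[[n - j - 1]]) ((A[[(j : ℤ)]]) v) = 0 := fun j => by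
      by_cases hj : M ≤ j
      · rw [hM _ hj, map_zero]
      · refine hK j _ ?_
        have : K j + j + 1 ≤ L := hL (Finset.mem_coe.2 (Finset.mem_image_of_mem (fun j : ℕ => K j + j + 1)
          (Finset.mem_range.2 (by omega : j < M.toNat))))
        have := le_max_right N L
        omega
    simp [nopMode, h1, h2])

end Fields

/-! ### `N_K = 1` supersymmetric structures, `Λ`-brackets and conformal vectors -/

/-- The data of an `N_K = 1` SUSY vertex algebra: the vacuum, the odd operator `S`, and the
components `Y(a, z)` at `θ = 0` of the superfields `Y(a, z, θ) = Y(a, z) + θ Y(S a, z)`. -/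
structure SUSYStructure (V : Type*) [AddCommGroup V] [Module ℂ V] where
  vac : V
  S : Module.End ℂ V
  Y : V →ₗ[ℂ] VertexOperator ℂ V

namespace SUSYStructure

variable {V : Type*} [AddCommGroup V] [Module ℂ V] (𝒱 : SUSYStructure V)

open scoped VertexOperator

/-- The translation operator `T = S²`. -/
def T : Module.End ℂ V := 𝒱.S * 𝒱.S

/-- The Fourier modes `a_(j|J)` of the superfield
`Y(a, z, θ) = ∑_j z^(-1-j) a_(j|1) + θ ∑_j z^(-1-j) a_(j|0)`. -/
def mode (a : V) (j : ℤ) (J : Fin 2) : Module.End ℂ V :=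
  if J = 0 then (𝒱.Y (𝒱.S a))[[j]] else (𝒱.Y a)[[j]]

/-- The normally ordered product `:ab: = a_(-1|1) b` of states. -/
def normalProd (a b : V) : V := 𝒱.mode a (-1) 1 b

/-- The `Λ`-bracket `[a_Λ b] = ∑_{j ≥ 0} λ^j / j! (a_(j|0) b + χ a_(j|1) b)`. A polynomial in the
even variable `λ` and the odd variable `χ` (where `χ² = -λ`), with coefficients in `V` written on
the right, is encoded by the family of its coefficients at `λ^j χ^J`. -/
def lambdaBracket (a b : V) : (ℕ × Fin 2) →₀ V :=
  Finsupp.ofSupportFinite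
    (fun p => ((p.1.factorial : ℂ)⁻¹) • 𝒱.mode a p.1 p.2 b) (by
      obtain ⟨N, hN⟩ := exists_ncoeff_eq_zero (𝒱.Y a) b
      obtain ⟨M, hM⟩ := exists_ncoeff_eq_zero (𝒱.Y (𝒱.S a)) b
      refine ((Set.finite_lt_nat (max N M).toNat).prod (Set.finite_univ (α := Fin 2))).subset ?_
      rintro ⟨j, J⟩ hj
      refine ⟨?_, Set.mem_univ _⟩
      by_contra hlt
      simp only [Set.mem_ofPred_eq] at hlt
      have := le_max_left N M
      have := le_max_right N M
      apply hj
      dsimp only [mode]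
      split_ifs
      · rw [hM _ (by omega), smul_zero]
      · rw [hN _ (by omega), smul_zero])

/-- The monomial `λ^j χ^J v`. -/
def mon (j : ℕ) (J : Fin 2) (v : V) : (ℕ × Fin 2) →₀ V := Finsupp.single (j, J) v

/-- `τ` is a Neveu–Schwarz vector of central charge `c`:
`[τ_Λ τ] = (2T + 3λ + χS) τ + (c/3) λ² χ |0⟩`. -/
def IsNeveuSchwarz (τ : V) (c : ℂ) : Prop :=
  𝒱.lambdaBracket τ τ =
    mon 0 0 ((2 : ℂ) • 𝒱.T τ) + mon 1 0 ((3 : ℂ) • τ) + mon 0 1 (𝒱.S τ) +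
      mon 2 1 ((c / 3) • 𝒱.vac)

/-- `τ` is an `N_K = 1` conformal vector of central charge `c`. -/
structure IsConformalVector (τ : V) (c : ℂ) : Prop where
  neveuSchwarz : 𝒱.IsNeveuSchwarz τ c
  mode_zero_zero : 𝒱.mode τ 0 0 = (2 : ℂ) • 𝒱.T
  mode_zero_one : 𝒱.mode τ 0 1 = 𝒱.S
  diagonalizable : ⨆ μ : ℂ, Module.End.eigenspace (𝒱.mode τ 1 0) μ = ⊤

/-- `a` is primary of conformal weight `Δ` with respect to `τ`:
`[τ_Λ a] = (2T + 2Δλ + χS) a`. -/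
def IsPrimary (τ a : V) (Δ : ℂ) : Prop :=
  𝒱.lambdaBracket τ a = mon 0 0 ((2 : ℂ) • 𝒱.T a) + mon 1 0 ((2 * Δ) • a) + mon 0 1 (𝒱.S a)

/-- The energy operator `τ_(1|0) / 2` has real eigenvalues bounded from below and
finite-dimensional eigenspaces. -/
def EnergyBoundedBelow (τ : V) : Prop :=
  (∃ C : ℝ, ∀ μ : ℂ, Module.End.HasEigenvalue (𝒱.mode τ 1 0) μ → ∃ x : ℝ, C ≤ x ∧ μ = x) ∧
    ∀ μ : ℂ, FiniteDimensional ℂ (Module.End.eigenspace (𝒱.mode τ 1 0) μ)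

end SUSYStructure

/-! ### The space `V¹(W) ⊗ ℂ_ε[Q]` -/

/-- Labels `(m, i)` of the creation operators `(b i)_(-m-1|J)` for a basis `b` of the lattice. -/
abbrev ModeIdx (r : ℕ) := ℕ ×ₗ Fin r

/-- Labels of the Poincaré–Birkhoff–Witt basis: `(ν, F, β)` stands for the vector
`∏_{(m,i)} ((b i)_(-m-1|0))^(ν (m,i)) · ∏_{(m,i) ∈ F} (b i)_(-m-1|1) |0⟩ ⊗ e^β`, where the odd
factors are written from left to right in increasing order. -/
abbrev FockIdx (r : ℕ) (Q : Type*) := (ModeIdx r →₀ ℕ) × Finset (ModeIdx r) × Q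

/-- The space `V¹(W) ⊗ ℂ_ε[Q]`. -/
abbrev Fock (r : ℕ) (Q : Type*) := FockIdx r Q →₀ ℂ

section Operators

variable {r : ℕ} {Q : Type*}

/-- The operator with prescribed values on the basis. -/
def onBasis (f : FockIdx r Q → Fock r Q) : Module.End ℂ (Fock r Q) :=
  Finsupp.linearCombination ℂ f

theorem onBasis_single (f : FockIdx r Q → Fock r Q) (s : FockIdx r Q) :
    onBasis f (Finsupp.single s 1) = f s := by
  simp [onBasis]

/-- Multiplication by the even generator with label `k`. -/
def evenCreate (k : ModeIdx r) : Module.End ℂ (Fock r Q) :=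
  onBasis fun s => Finsupp.single (s.1 + Finsupp.single k 1, s.2.1, s.2.2) 1

/-- Partial derivative by the even generator with label `k`. -/
def evenDeriv (k : ModeIdx r) : Module.End ℂ (Fock r Q) :=
  onBasis fun s => Finsupp.single (s.1 - Finsupp.single k 1, s.2.1, s.2.2) (s.1 k : ℂ)

/-- Left multiplication by the odd generator with label `k`. -/
def oddCreate (k : ModeIdx r) : Module.End ℂ (Fock r Q) :=
  onBasis fun s => if k ∈ s.2.1 then 0 else
    Finsupp.single (s.1, insert k s.2.1, s.2.2) ((-1) ^ (s.2.1.filter (· < k)).card)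

/-- Left partial derivative by the odd generator with label `k`. -/
def oddDeriv (k : ModeIdx r) : Module.End ℂ (Fock r Q) :=
  onBasis fun s => if k ∈ s.2.1 then
    Finsupp.single (s.1, s.2.1.erase k, s.2.2) ((-1) ^ (s.2.1.filter (· < k)).card) else 0

theorem trunc_of_basis (f : ℤ → Module.End ℂ (Fock r Q))
    (h : ∀ s, ∃ N : ℤ, ∀ n, N ≤ n → f n (Finsupp.single s 1) = 0) (v : Fock r Q) :
    ∃ N : ℤ, ∀ n, N ≤ n → f n v = 0 := by
  induction v using Finsupp.induction_linear with
  | zero => exact ⟨0, fun n _ => map_zero _⟩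
  | add v w hv hw =>
    obtain ⟨N, hN⟩ := hv
    obtain ⟨M, hM⟩ := hw
    exact ⟨max N M, fun n hn => by
      rw [map_add, hN n (le_trans (le_max_left _ _) hn), hM n (le_trans (le_max_right _ _) hn),
        add_zero]⟩
  | single s c =>
    obtain ⟨N, hN⟩ := h s
    refine ⟨N, fun n hn => ?_⟩
    rw [← mul_one c, ← smul_eq_mul, ← Finsupp.smul_single, map_smul, hN n hn, smul_zero]

theorem evenDeriv_eq_zero (s : FockIdx r Q) (k : ModeIdx r) (hk : s.1 k = 0) :
    evenDeriv k (Finsupp.single s 1) = 0 := by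
  simp [evenDeriv, onBasis_single, hk]

theorem oddDeriv_eq_zero (s : FockIdx r Q) (k : ModeIdx r) (hk : k ∉ s.2.1) :
    oddDeriv k (Finsupp.single s 1) = 0 := by
  simp [oddDeriv, onBasis_single, hk]

theorem exists_bound (F : Finset (ModeIdx r)) : ∃ N : ℕ, ∀ k ∈ F, (ofLex k).1 < N := by
  refine ⟨F.sup (fun k => (ofLex k).1) + 1, fun k hk => ?_⟩
  exact Nat.lt_succ_of_le (Finset.le_sup (f := fun k : ModeIdx r => (ofLex k).1) hk)

/-- The degree of a basis vector in the even generators, `(b i)_(-m-1|0)` having degree `m + 1`. -/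
def evenDegree (s : FockIdx r Q) : ℤ := s.1.sum fun k c => (c : ℤ) * ((ofLex k).1 + 1)

/-- The span of the basis vectors of degree at most `d`. -/
def degLE (r : ℕ) (Q : Type*) (d : ℤ) : Submodule ℂ (Fock r Q) :=
  Finsupp.supported ℂ ℂ {s | evenDegree s ≤ d}

/-- `A` lowers the degree by at least `q`. -/
def Lowers (q : ℕ) (A : Module.End ℂ (Fock r Q)) : Prop :=
  ∀ (d : ℤ), ∀ v ∈ degLE r Q d, A v ∈ degLE r Q (d - q)

theorem evenDegree_nonneg (s : FockIdx r Q) : 0 ≤ evenDegree s :=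
  Finset.sum_nonneg fun k _ => by positivity

theorem degLE_of_neg {d : ℤ} (hd : d < 0) {v : Fock r Q} (hv : v ∈ degLE r Q d) : v = 0 := by
  have : {s : FockIdx r Q | evenDegree s ≤ d} = ∅ := by
    ext s
    have := evenDegree_nonneg s
    simp only [Set.mem_ofPred_eq, Set.mem_empty_iff_false, iff_false]
    omega
  rw [degLE, this, Finsupp.supported_empty] at hv
  exact hv

theorem Lowers.zero (q : ℕ) : Lowers q (0 : Module.End ℂ (Fock r Q)) :=
  fun _ _ _ => Submodule.zero_mem _

theorem Lowers.smul {q : ℕ} {A : Module.End ℂ (Fock r Q)} (hA : Lowers q A) (c : ℂ) :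
    Lowers q (c • A) :=
  fun d v hv => Submodule.smul_mem _ _ (hA d v hv)

theorem Lowers.sum {ι : Type*} {q : ℕ} (t : Finset ι) {A : ι → Module.End ℂ (Fock r Q)}
    (hA : ∀ i ∈ t, Lowers q (A i)) : Lowers q (∑ i ∈ t, A i) := by
  intro d v hv
  rw [LinearMap.sum_apply]
  exact Submodule.sum_mem _ fun i hi => hA i hi d v hv

theorem Lowers.mul {p q : ℕ} {A A' : Module.End ℂ (Fock r Q)} (hA : Lowers p A)
    (hA' : Lowers q A') : Lowers (p + q) (A * A') := by
  intro d v hv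
  have := hA _ _ (hA' d v hv)
  rw [Module.End.mul_apply]
  convert this using 2
  push_cast
  ring

theorem lowers_evenDeriv (k : ModeIdx r) :
    Lowers ((ofLex k).1 + 1) (evenDeriv k : Module.End ℂ (Fock r Q)) := by
  intro d v hv
  rw [evenDeriv, onBasis, Finsupp.linearCombination_apply]
  refine Submodule.sum_mem _ fun s hs => Submodule.smul_mem _ _ ?_
  by_cases hk : s.1 k = 0
  · simp [hk]
  refine Finsupp.single_mem_supported ℂ _ ?_
  have hs' : evenDegree s ≤ d := hv hs
  have key : evenDegree s = evenDegree (s.1 - Finsupp.single k 1, s.2.1, s.2.2) +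
      ((ofLex k).1 + 1) := by
    have h1 : s.1 = (s.1 - Finsupp.single k 1) + Finsupp.single k 1 := by
      refine (tsub_add_cancel_of_le ?_).symm
      rw [Finsupp.single_le_iff]
      omega
    simp only [evenDegree]
    conv_lhs => rw [h1]
    rw [Finsupp.sum_add_index' (by simp) (by intros; push_cast; ring),
      Finsupp.sum_single_index (by simp)]
    simp
  simp only [Set.mem_ofPred_eq]
  push_cast
  omega

theorem lowers_coeff_pow {X : PowerSeries (Module.End ℂ (Fock r Q))}
    (hX : ∀ n, Lowers n (PowerSeries.coeff n X)) (m n : ℕ) :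
    Lowers n (PowerSeries.coeff n (X ^ m)) := by
  induction m generalizing n with
  | zero =>
    rw [pow_zero, PowerSeries.coeff_one]
    split_ifs with h
    · subst h
      intro d v hv
      simpa using hv
    · exact Lowers.zero n
  | succ m ih =>
    rw [pow_succ, PowerSeries.coeff_mul]
    refine Lowers.sum _ fun p hp => ?_
    rw [← Finset.HasAntidiagonal.mem_antidiagonal.1 hp]
    exact (ih p.1).mul (hX p.2)

end Operators

/-! ### The operators `h_(j|J)`, `e^α`, `S` and the vertex operators -/

section Lattice

variable {r : ℕ} {Q : Type*} [AddCommGroup Q]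
  (B : LinearMap.BilinForm ℤ Q) (b : Module.Basis (Fin r) ℤ Q) (ε : Q → Q → ℂˣ)

/-- The bilinear form on `W = ℂ ⊗ Q`. -/
def formW : LinearMap.BilinForm ℂ (ℂ ⊗[ℤ] Q) := LinearMap.BilinForm.baseChange ℂ B

/-- The inclusion of `Q` into `W`. -/
def toW (α : Q) : ℂ ⊗[ℤ] Q := 1 ⊗ₜ[ℤ] α

/-- The coordinates of `h ∈ W` in the basis `b`. -/
def coordW (h : ℂ ⊗[ℤ] Q) (i : Fin r) : ℂ := (Algebra.TensorProduct.basis ℂ b).repr h i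

/-- The operators `h_(n|0)`; they satisfy `[h_(m|0), h'_(n|0)] = m (h, h') δ_{m,-n}`, and
`h_(0|0)` is `(h, β)` on `V¹(W) ⊗ e^β`. -/
def evenMode (h : ℂ ⊗[ℤ] Q) : ℤ → Module.End ℂ (Fock r Q)
  | .ofNat 0 => onBasis fun s => Finsupp.single s (formW B h (toW s.2.2))
  | .ofNat (m + 1) =>
      ((m : ℂ) + 1) • ∑ i, formW B h (toW (b i)) • evenDeriv (toLex (m, i))
  | .negSucc m => ∑ i, coordW b h i • evenCreate (toLex (m, i))

/-- The operators `h_(n|1)`; they satisfy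
`h_(m|1) h'_(n|1) + h'_(n|1) h_(m|1) = (h, h') δ_{m,-n-1}`. -/
def oddMode (h : ℂ ⊗[ℤ] Q) : ℤ → Module.End ℂ (Fock r Q)
  | .ofNat m => ∑ i, formW B h (toW (b i)) • oddDeriv (toLex (m, i))
  | .negSucc m => ∑ i, coordW b h i • oddCreate (toLex (m, i))

/-- The even current `(S h)(z) = ∑ h_(n|0) z^(-1-n)`. -/
def evenField (h : ℂ ⊗[ℤ] Q) : VertexOperator ℂ (Fock r Q) :=
  ofModes (evenMode B b h) (trunc_of_basis _ (by
    intro s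
    obtain ⟨N, hN⟩ := exists_bound s.1.support
    refine ⟨N + 1, fun n hn => ?_⟩
    obtain ⟨m, rfl⟩ : ∃ m : ℕ, n = Int.ofNat (m + 1) := ⟨(n - 1).toNat, by simp; omega⟩
    simp only [evenMode, LinearMap.smul_apply, LinearMap.sum_apply]
    rw [Finset.sum_eq_zero, smul_zero]
    intro i _
    rw [evenDeriv_eq_zero, smul_zero]
    by_contra hk
    have := hN _ (Finsupp.mem_support_iff.2 hk)
    simp at this hn
    omega))

/-- The odd field `h(z) = ∑ h_(n|1) z^(-1-n)`. -/
def oddField (h : ℂ ⊗[ℤ] Q) : VertexOperator ℂ (Fock r Q) :=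
  ofModes (oddMode B b h) (trunc_of_basis _ (by
    intro s
    obtain ⟨N, hN⟩ := exists_bound s.2.1
    refine ⟨N, fun n hn => ?_⟩
    obtain ⟨m, rfl⟩ : ∃ m : ℕ, n = Int.ofNat m := ⟨n.toNat, by simp; omega⟩
    simp only [oddMode, LinearMap.smul_apply, LinearMap.sum_apply]
    refine Finset.sum_eq_zero fun i _ => ?_
    rw [oddDeriv_eq_zero, smul_zero]
    intro hk
    have := hN _ hk
    simp at this hn
    omega))

/-- Multiplication by `1 ⊗ e^α`, with the sign rule for moving `e^α`, of parity `(α, α)`, past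
the odd generators. -/
def expMul (α : Q) : Module.End ℂ (Fock r Q) :=
  onBasis fun s => Finsupp.single (s.1, s.2.1, α + s.2.2)
    ((-1 : ℂ) ^ (B α α * s.2.1.card) * (ε α s.2.2 : ℂ))

/-- The exponential `∑ X^m / m!` of a power series without constant term. -/
def expSeries {R : Type*} [Ring R] [Module ℂ R] (X : PowerSeries R) : PowerSeries R :=
  PowerSeries.mk fun n =>
    ∑ m ∈ Finset.range (n + 1), ((m.factorial : ℂ)⁻¹) • PowerSeries.coeff n (X ^ m)

/-- `exp (- ∑_{j<0} (z^(-j) / j) α_(j|0))`, a power series in `z` (the constant term of the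
exponent is zero). -/
def expMinus (α : Q) : PowerSeries (Module.End ℂ (Fock r Q)) :=
  expSeries (PowerSeries.mk fun n => ((n : ℂ)⁻¹) • evenMode B b (toW α) (-(n : ℤ)))

/-- `exp (- ∑_{j>0} (z^(-j) / j) α_(j|0))`, a power series in `z⁻¹` (the constant term of the
exponent is zero). -/
def expPlus (α : Q) : PowerSeries (Module.End ℂ (Fock r Q)) :=
  expSeries (PowerSeries.mk fun n => (-(n : ℂ)⁻¹) • evenMode B b (toW α) (n : ℤ))

/-- The coefficient of `z^k` in `expMinus`, for an integer `k`. -/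
def expMinusCoeff (α : Q) (k : ℤ) : Module.End ℂ (Fock r Q) :=
  if 0 ≤ k then PowerSeries.coeff k.toNat (expMinus B b α) else 0

/-- The mode `n` (the coefficient of `z^(-1-n)`) of
`e^α z^(α_(0|0)) exp (- ∑_{j<0} (z^(-j) / j) α_(j|0)) exp (- ∑_{j>0} (z^(-j) / j) α_(j|0))`. -/
def gammaMode (α : Q) (n : ℤ) : Module.End ℂ (Fock r Q) :=
  onBasis fun s => ∑ᶠ q : ℕ, expMul B ε α
    (expMinusCoeff B b α (q - 1 - n - B α s.2.2)
      (PowerSeries.coeff q (expPlus B b α) (Finsupp.single s 1)))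

theorem lowers_expPlus (α : Q) (q : ℕ) : Lowers q (PowerSeries.coeff q (expPlus B b α)) := by
  rw [expPlus, expSeries, PowerSeries.coeff_mk]
  refine Lowers.sum _ fun m _ => Lowers.smul (lowers_coeff_pow (fun n => ?_) m q) _
  rw [PowerSeries.coeff_mk]
  cases n with
  | zero => simpa using Lowers.zero 0
  | succ n =>
    have h : Lowers (n + 1) (evenMode B b (toW α) (Int.ofNat (n + 1))) := by
      rw [evenMode]
      refine Lowers.smul (Lowers.sum _ fun i _ => Lowers.smul ?_ _) _
      exact lowers_evenDeriv (toLex (n, i))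
    exact h.smul _

theorem expPlus_eq_zero (α : Q) (s : FockIdx r Q) (q : ℕ) (hq : evenDegree s < q) :
    PowerSeries.coeff q (expPlus B b α) (Finsupp.single s 1) = 0 :=
  degLE_of_neg (by omega : evenDegree s - (q : ℤ) < 0)
    (lowers_expPlus B b α q _ _ (Finsupp.single_mem_supported ℂ _ (le_refl (evenDegree s))))

/-- The vertex operator `Γ_α(z, θ)` at `θ = 0`. -/
def gammaField (α : Q) : VertexOperator ℂ (Fock r Q) :=
  ofModes (gammaMode B b ε α) (trunc_of_basis _ (by
    intro s
    refine ⟨evenDegree s - B α s.2.2, fun n hn => ?_⟩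
    rw [gammaMode, onBasis_single]
    refine finsum_eq_zero_of_forall_eq_zero fun q => ?_
    by_cases hq : evenDegree s < q
    · rw [expPlus_eq_zero B b α s q hq, map_zero, map_zero]
    · rw [expMinusCoeff, if_neg (by omega), LinearMap.zero_apply, map_zero]))

/-- The divided derivative `∂^m A(z) / m!`. -/
def dividedDeriv (m : ℕ) (A : VertexOperator ℂ (Fock r Q)) : VertexOperator ℂ (Fock r Q) :=
  ((m.factorial : ℂ)⁻¹) • fieldDeriv^[m] A

/-- The field of the state `∏_{k ∈ l} (b k.2)_(-k.1-1|1) |0⟩ ⊗ e^β`. -/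
def oddPart (β : Q) : List (ModeIdx r) → VertexOperator ℂ (Fock r Q)
  | [] => gammaField B b ε β
  | k :: l => nop ((-1 : ℂ) ^ ((l.length : ℤ) + B β β))
      (dividedDeriv (ofLex k).1 (oddField B b (toW (b (ofLex k).2)))) (oddPart β l)

/-- The field of the state `∏_{k ∈ l} (b k.2)_(-k.1-1|0) v`, where `A` is the field of `v`. -/
def evenPart (A : VertexOperator ℂ (Fock r Q)) : List (ModeIdx r) → VertexOperator ℂ (Fock r Q)
  | [] => A
  | k :: l => nop 1 (dividedDeriv (ofLex k).1 (evenField B b (toW (b (ofLex k).2))))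
      (evenPart A l)

/-- The operator `S`: the odd operator with `[S, h_(n|1)] = h_(n|0)`,
`[S, h_(n|0)] = -n h_(n-1|1)` and `S (1 ⊗ e^β) = β_(-1|1) ⊗ e^β`. -/
def opS : Module.End ℂ (Fock r Q) :=
  onBasis fun s =>
    (∑ k ∈ s.1.support, (((ofLex k).1 : ℂ) + 1) •
      oddCreate (toLex ((ofLex k).1 + 1, (ofLex k).2)) (evenDeriv k (Finsupp.single s 1))) +
    (∑ k ∈ s.2.1, evenCreate k (oddDeriv k (Finsupp.single s 1))) +
    oddMode B b (toW s.2.2) (-1) (Finsupp.single s 1)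

/-- The vacuum, `|0⟩ ⊗ 1`, where `1 = ε(0,0)⁻¹ e^0` is the unit of the twisted group algebra. -/
def vacuum : Fock r Q := Finsupp.single (0, ∅, 0) (((ε 0 0)⁻¹ : ℂˣ) : ℂ)

/-- The SUSY lattice vertex algebra `V_Q^super`. The field of a basis vector is the normally
ordered product of divided derivatives of the free fields and of a vertex operator:
`Y(h_(-m-1|J) v, z) = :(∂^m h^J(z) / m!) Y(v, z):`, where `h^1(z)` is the odd field `h(z)` and
`h^0(z)` is the even field `(S h)(z)`. -/
def vQ : SUSYStructure (Fock r Q) where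
  vac := vacuum ε
  S := opS B b
  Y := Finsupp.linearCombination ℂ fun s =>
    evenPart B b (oddPart B b ε s.2.2 (s.2.1.sort (· ≤ ·)))
      ((Finsupp.toMultiset s.1).sort (· ≤ ·))

/-- The state `h = h_(-1|1) |0⟩` attached to `h ∈ W`. -/
def stateW (h : ℂ ⊗[ℤ] Q) : Fock r Q := oddMode B b h (-1) (vacuum ε)

/-- The state `1 ⊗ e^α`, whose superfield is `Γ_α`. -/
def stateExp (r : ℕ) (α : Q) : Fock r Q := Finsupp.single (0, ∅, α) 1

/-- The vector `G = ∑ᵢ :(S αᵢ) αⁱ:` for two families `a`, `a'` in `W`. -/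
def vecG {κ : Type*} [Fintype κ] (a a' : κ → ℂ ⊗[ℤ] Q) : Fock r Q :=
  ∑ i, (vQ B b ε).normalProd ((vQ B b ε).S (stateW B b ε (a i))) (stateW B b ε (a' i))

end Lattice

end SUSYLattice

end

open scoped TensorProduct

noncomputable section

namespace SUSYLattice

/-! ### Modes of normally ordered products -/

section FieldLemmas

open scoped VertexOperator

variable {V : Type*} [AddCommGroup V] [Module ℂ V]

/-! In a basis `b` of the lattice, dual bases of `W` enter only through the Casimir coordinates `c`,
which form the inverse Gram matrix. Hence `G` is the vector `∑ c_{lm} (b_l)_(-1|0) (b_m)_(-1|1)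
|0⟩`, and the two components of its superfield are quadratic in free fields: the modes `G_(n|1)` are
`modeG` and the modes `G_(n|0)` are `modeL`.

Bracketing a free mode with one factor of a normally ordered product leaves a scalar field times the
other factor, and contraction with the inverse Gram matrix turns that factor back into the original
vector. For `h` in the lattice basis this gives `[h_(m|0), G_(n|1)] = m h_(n-1+m|1)`
(`evenMode_mul_modeG`) and `{h_(m|1), G_(n|1)} = h_(n+m|0)` (`oddMode_mul_modeG`). A comparison on
basis vectors gives `G_(0|1) = S` (`modeG_zero`). Since `S` is a superderivation of the free fields,
`G_(n|0) = {S, G_(n|1)}` (`modeL_eq`); so `G_(0|0) = 2S² = 2T`, and Jacobi identities yield the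
commutators of `G_(n|0)` with all free modes.

The rest is evaluation on states created from `1 ⊗ e^β`. There `G_(n|1)` vanishes for `n > 0`, and
`G_(n|0)` acts as `β_(n-1|0)`; commuting past creation operators settles the brackets. The central
term is the trace of the inverse Gram matrix against the Gram matrix, which is the rank. The
operator `G_(1|0)` is diagonal in the Poincaré–Birkhoff–Witt basis, with integer eigenvalue
`fockWeight`. For a positive definite form these weights are nonnegative and only finitely many
basis vectors lie below any bound.

Primarity of `Γ_α` concerns only the modes of `G` on the state `1 ⊗ e^α`, so the only vertex
operator to be computed is that of `e^0`, a constant. -/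

theorem vertexOperator_ext_ncoeff {A B : VertexOperator ℂ V} (h : ∀ n, A[[n]] = B[[n]]) :
    A = B := by
  apply HVertexOperator.coeff_inj
  funext n
  rw [VertexOperator.coeff_eq_ncoeff, VertexOperator.coeff_eq_ncoeff, h]

theorem fieldDeriv_ncoeff (A : VertexOperator ℂ V) (n : ℤ) :
    (fieldDeriv A)[[n]] = (-(n : ℂ)) • A[[n - 1]] := ofModes_ncoeff _ _ n

theorem nop_ncoeff (σ : ℂ) (A B : VertexOperator ℂ V) (n : ℤ) :
    (nop σ A B)[[n]] = nopMode σ A B n := ofModes_ncoeff _ _ n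

theorem nopMode_apply (σ : ℂ) (A B : VertexOperator ℂ V) (n : ℤ) (v : V) :
    nopMode σ A B n v = (∑ᶠ j : ℕ, (A[[-(j : ℤ) - 1]]) ((B[[n + j]]) v)) +
      σ • ∑ᶠ j : ℕ, (B[[n - j - 1]]) ((A[[(j : ℤ)]]) v) := rfl

/-- The field `c z^(-1-j₀)`. -/
def constField (V : Type*) [AddCommGroup V] [Module ℂ V] (j₀ : ℤ) (c : ℂ) :
    VertexOperator ℂ V :=
  ofModes (fun j => if j = j₀ then c • 1 else 0) fun v => ⟨j₀ + 1, fun n hn => by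
    rw [if_neg (by omega), LinearMap.zero_apply]⟩

theorem constField_ncoeff (j₀ : ℤ) (c : ℂ) (n : ℤ) :
    (constField V j₀ c)[[n]] = if n = j₀ then c • 1 else 0 := ofModes_ncoeff _ _ n

/-- Each half of a normally ordered product runs over natural numbers, while the single surviving
index is an integer. It contributes to this half exactly when it is nonnegative. -/
theorem finsum_nat_eq_smul {g : ℕ → V} (j₀ : ℤ) (c : ℂ) (f : ℤ → V)
    (hg : ∀ j : ℕ, g j = if (j : ℤ) = j₀ then c • f j else 0) :
    ∑ᶠ j, g j = if 0 ≤ j₀ then c • f j₀ else 0 := by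
  split_ifs with h
  · lift j₀ to ℕ using h
    rw [finsum_eq_single _ j₀ fun j hj => by rw [hg, if_neg (by exact_mod_cast hj)],
      hg, if_pos rfl]
  · exact finsum_eq_zero_of_forall_eq_zero fun j => by rw [hg, if_neg (by omega)]

theorem nopMode_constField_left (j₀ : ℤ) (c : ℂ) (B : VertexOperator ℂ V) (n : ℤ) :
    nopMode 1 (constField V j₀ c) B n = c • B[[n - 1 - j₀]] := by
  ext v
  rw [nopMode_apply,
    finsum_nat_eq_smul (-j₀ - 1) c (fun i : ℤ => (B[[n + i]]) v) fun j => by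
      rw [constField_ncoeff]; split_ifs <;> first | omega | simp,
    finsum_nat_eq_smul j₀ c (fun i : ℤ => (B[[n - i - 1]]) v) fun j => by
      rw [constField_ncoeff]; split_ifs <;> simp]
  -- The surviving mode lies in exactly one of the two halves, and both halves give the same
  -- operator because a scalar commutes with everything.
  by_cases h : 0 ≤ j₀
  · rw [if_neg (by omega), if_pos h, zero_add, one_smul, LinearMap.smul_apply]
    rw [show n - j₀ - 1 = n - 1 - j₀ by ring]
  · rw [if_pos (by omega), if_neg h, smul_zero, add_zero, LinearMap.smul_apply]
    rw [show n + (-j₀ - 1) = n - 1 - j₀ by ring]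

theorem nopMode_constField_right (k₀ : ℤ) (c : ℂ) (A : VertexOperator ℂ V) (n : ℤ) :
    nopMode 1 A (constField V k₀ c) n = c • A[[n - 1 - k₀]] := by
  ext v
  rw [nopMode_apply,
    finsum_nat_eq_smul (k₀ - n) c (fun i : ℤ => (A[[-i - 1]]) v) fun j => by
      rw [constField_ncoeff]; split_ifs <;> first | omega | simp,
    finsum_nat_eq_smul (n - 1 - k₀) c (fun i : ℤ => (A[[i]]) v) fun j => by
      rw [constField_ncoeff]; split_ifs <;> first | omega | simp]
  by_cases h : 0 ≤ k₀ - n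
  · rw [if_pos h, if_neg (by omega), smul_zero, add_zero, LinearMap.smul_apply]
    rw [show -(k₀ - n) - 1 = n - 1 - k₀ by ring]
  · rw [if_neg h, if_pos (by omega), zero_add, one_smul, LinearMap.smul_apply]

theorem nopMode_smul_right (σ c : ℂ) (A B : VertexOperator ℂ V) (n : ℤ) :
    nopMode σ A (c • B) n = c • nopMode σ A B n := by
  ext v
  simp only [nopMode_apply, LinearMap.smul_apply, map_smul, Pi.smul_apply]
  rw [← smul_finsum, ← smul_finsum, smul_add, smul_comm σ c]

/-- An operator that (anti)commutes with the modes of two fields up to the modes of further fields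
acts on their normally ordered product as a derivation. -/
theorem mul_nopMode {X : Module.End ℂ V} {A B A' B' : VertexOperator ℂ V} {s t : ℂ} (σ : ℂ)
    (hs : s * s = 1)
    (hA : ∀ j, X * A[[j]] = s • (A[[j]] * X) + A'[[j]])
    (hB : ∀ j, X * B[[j]] = t • (B[[j]] * X) + B'[[j]]) (n : ℤ) :
    X * nopMode σ A B n = (s * t) • (nopMode σ A B n * X) + nopMode (σ * t) A' B n +
      s • nopMode (σ * s) A B' n := by
  ext v
  have hA' : ∀ j w, X ((A[[j]]) w) = s • (A[[j]]) (X w) + (A'[[j]]) w := fun j w => by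
    simpa using LinearMap.congr_fun (hA j) w
  have hB' : ∀ j w, X ((B[[j]]) w) = t • (B[[j]]) (X w) + (B'[[j]]) w := fun j w => by
    simpa using LinearMap.congr_fun (hB j) w
  simp only [Module.End.mul_apply, LinearMap.add_apply, LinearMap.smul_apply, nopMode_apply,
    map_add, map_smul]
  rw [map_finsum X (finite_support_left A B n v), map_finsum X (finite_support_right A B n v)]
  have e1 : ∀ j : ℕ, X ((A[[-(j : ℤ) - 1]]) ((B[[n + j]]) v)) =
      (s * t) • (A[[-(j : ℤ) - 1]]) ((B[[n + j]]) (X v)) +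
        (s • (A[[-(j : ℤ) - 1]]) ((B'[[n + j]]) v) + (A'[[-(j : ℤ) - 1]]) ((B[[n + j]]) v)) := by
    intro j
    rw [hA', hB', map_add, map_smul]; module
  have e2 : ∀ j : ℕ, X ((B[[n - j - 1]]) ((A[[(j : ℤ)]]) v)) =
      (s * t) • (B[[n - j - 1]]) ((A[[(j : ℤ)]]) (X v)) +
        (t • (B[[n - j - 1]]) ((A'[[(j : ℤ)]]) v) + (B'[[n - j - 1]]) ((A[[(j : ℤ)]]) v)) := by
    intro j
    rw [hB', hA', map_add, map_smul]; module
  have fin_smul : ∀ (c : ℂ) {f : ℕ → V}, (Function.support f).Finite →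
      (Function.support fun j => c • f j).Finite := fun c f hf =>
    hf.subset fun j hj h => hj (by simp [h])
  rw [finsum_congr e1, finsum_congr e2,
    finsum_add_distrib (fin_smul _ (finite_support_left A B n (X v)))
      (((fin_smul _ (finite_support_left A B' n v)).union (finite_support_left A' B n v)).subset
        (Function.support_add _ _)),
    finsum_add_distrib (fin_smul _ (finite_support_left A B' n v)) (finite_support_left A' B n v),
    finsum_add_distrib (fin_smul _ (finite_support_right A B n (X v)))
      (((fin_smul _ (finite_support_right A' B n v)).union (finite_support_right A B' n v)).subset
        (Function.support_add _ _)),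
    finsum_add_distrib (fin_smul _ (finite_support_right A' B n v)) (finite_support_right A B' n v),
    ← smul_finsum, ← smul_finsum, ← smul_finsum, ← smul_finsum]
  -- In the half where `B` stands to the left, `X` reaches `B` without crossing `A` and picks up no
  -- `s`. Pulling `s` out of the whole product with `B'` is compensated by `s * s = 1`.
  have hs2 : s • (σ * s) • (∑ᶠ j : ℕ, (B'[[n - j - 1]]) ((A[[(j : ℤ)]]) v)) =
      σ • ∑ᶠ j : ℕ, (B'[[n - j - 1]]) ((A[[(j : ℤ)]]) v) := by
    rw [smul_smul, show s * (σ * s) = σ * (s * s) by ring, hs, mul_one]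
  rw [smul_add s, hs2]
  module

theorem finsum_int_eq_add {M : Type*} [AddCommMonoid M] {f : ℤ → M} (hf : (Function.support f).Finite) :
    ∑ᶠ j, f j = (∑ᶠ j : ℕ, f (-(j : ℤ) - 1)) + ∑ᶠ j : ℕ, f j := by
  have i1 : Function.Injective fun j : ℕ => -(j : ℤ) - 1 := fun i j h => by
    simpa using h
  have i2 : Function.Injective fun j : ℕ => (j : ℤ) := Nat.cast_injective
  have hu : (Set.univ : Set ℤ) =
      (Set.range fun j : ℕ => -(j : ℤ) - 1) ∪ Set.range fun j : ℕ => (j : ℤ) := by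
    ext j
    simp only [Set.mem_univ, Set.mem_union, Set.mem_range, true_iff]
    rcases le_or_gt 0 j with h | h
    · exact Or.inr ⟨j.toNat, by omega⟩
    · exact Or.inl ⟨(-j - 1).toNat, by omega⟩
  rw [← finsum_mem_univ, hu, finsum_mem_union' ?_ (hf.subset Set.inter_subset_right)
    (hf.subset Set.inter_subset_right), finsum_mem_range i1, finsum_mem_range i2]
  rw [Set.disjoint_left]
  rintro _ ⟨i, rfl⟩ ⟨j, hj⟩
  simp only at hj
  omega

theorem nopMode_one_eq_finsum (A B : VertexOperator ℂ V) (n : ℤ) (v : V) :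
    nopMode 1 A B n v = ∑ᶠ j : ℤ, if j < 0 then (A[[j]]) ((B[[n - 1 - j]]) v) else
      (B[[n - 1 - j]]) ((A[[j]]) v) := by
  obtain ⟨N, hN⟩ := exists_ncoeff_eq_zero A v
  obtain ⟨K, hK⟩ := exists_ncoeff_eq_zero B v
  rw [finsum_int_eq_add, nopMode_apply, one_smul]
  · congr 1
    · refine finsum_congr fun j => ?_
      rw [if_pos (by omega), show n - 1 - (-(j : ℤ) - 1) = n + j by ring]
    · refine finsum_congr fun j => ?_
      rw [if_neg (by omega), show n - 1 - (j : ℤ) = n - j - 1 by ring]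
  · refine (Set.finite_Icc (min 0 (n - 1 - K)) (max 0 N)).subset fun j hj => ?_
    by_contra hc
    refine hj ?_
    simp only [Set.mem_Icc, not_and_or, not_le] at hc
    dsimp only
    split_ifs with h
    · rw [hK _ (by omega), map_zero]
    · rw [hN _ (by omega), map_zero]

/-- The mode `n` of a normally ordered product does not depend on the order of the fields if the
products of modes that are ordered differently commute. -/
theorem nopMode_swap {A B : VertexOperator ℂ V} {n : ℤ}
    (h : ∀ j, (j < 0 ↔ 0 ≤ n - 1 - j) ∨ A[[j]] * B[[n - 1 - j]] = B[[n - 1 - j]] * A[[j]]) :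
    nopMode 1 A B n = nopMode 1 B A n := by
  ext v
  rw [nopMode_one_eq_finsum, nopMode_one_eq_finsum, ← finsum_comp_equiv (Equiv.subLeft (n - 1))]
  refine finsum_congr fun j => ?_
  simp only [Equiv.subLeft_apply]
  rw [show n - 1 - (n - 1 - j) = j by ring]
  have h' := h (n - 1 - j)
  rw [show n - 1 - (n - 1 - j) = j by ring] at h'
  rcases h' with h' | h'
  · split_ifs <;> first | rfl | omega
  · have := LinearMap.congr_fun h' v
    simp only [Module.End.mul_apply] at this
    rw [this, ite_self, ite_self]

end FieldLemmas

/-! ### Canonical commutation and anticommutation relations on the basis -/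

section CanonicalRelations

variable {r : ℕ} {Q : Type*}

theorem end_ext_single {X Y : Module.End ℂ (Fock r Q)}
    (h : ∀ s, X (Finsupp.single s 1) = Y (Finsupp.single s 1)) : X = Y :=
  Finsupp.lhom_ext' fun s => LinearMap.ext_ring (h s)

theorem onBasis_single_smul (f : FockIdx r Q → Fock r Q) (s : FockIdx r Q) (c : ℂ) :
    onBasis f (Finsupp.single s c) = c • f s := by
  simp [onBasis]

theorem evenCreate_single (k : ModeIdx r) (s : FockIdx r Q) (c : ℂ) :
    evenCreate k (Finsupp.single s c) =
      Finsupp.single (s.1 + Finsupp.single k 1, s.2.1, s.2.2) c := by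
  simp [evenCreate, onBasis_single_smul]

theorem evenDeriv_single (k : ModeIdx r) (s : FockIdx r Q) (c : ℂ) :
    evenDeriv k (Finsupp.single s c) =
      Finsupp.single (s.1 - Finsupp.single k 1, s.2.1, s.2.2) (c * s.1 k) := by
  simp [evenDeriv, onBasis_single_smul]

/-- The sign `(-1)^#{x ∈ F | x < k}`. -/
def oddSign (F : Finset (ModeIdx r)) (k : ModeIdx r) : ℂ := (-1) ^ (F.filter (· < k)).card

theorem oddSign_mul_self (F : Finset (ModeIdx r)) (k : ModeIdx r) :
    oddSign F k * oddSign F k = 1 := by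
  rw [oddSign, ← mul_pow]
  simp

theorem oddSign_insert {F : Finset (ModeIdx r)} {l : ModeIdx r} (hl : l ∉ F) (k : ModeIdx r) :
    oddSign (insert l F) k = if l < k then -oddSign F k else oddSign F k := by
  rw [oddSign, oddSign, Finset.filter_insert]
  split_ifs
  · rw [Finset.card_insert_of_notMem (by simp [hl]), pow_succ]
    ring
  · rfl

theorem oddSign_erase {F : Finset (ModeIdx r)} {l : ModeIdx r} (hl : l ∈ F) (k : ModeIdx r) :
    oddSign (F.erase l) k = if l < k then -oddSign F k else oddSign F k := by
  have := oddSign_insert (F.notMem_erase l) k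
  rw [Finset.insert_erase hl] at this
  rw [this]
  split_ifs <;> ring

theorem oddCreate_single (k : ModeIdx r) (s : FockIdx r Q) (c : ℂ) :
    oddCreate k (Finsupp.single s c) = if k ∈ s.2.1 then 0 else
      Finsupp.single (s.1, insert k s.2.1, s.2.2) (c * oddSign s.2.1 k) := by
  rw [oddCreate, onBasis_single_smul]
  split_ifs <;> simp [oddSign]

theorem oddDeriv_single (k : ModeIdx r) (s : FockIdx r Q) (c : ℂ) :
    oddDeriv k (Finsupp.single s c) = if k ∈ s.2.1 then
      Finsupp.single (s.1, s.2.1.erase k, s.2.2) (c * oddSign s.2.1 k) else 0 := by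
  rw [oddDeriv, onBasis_single_smul]
  split_ifs <;> simp [oddSign]

theorem evenCreate_comm (k l : ModeIdx r) :
    (evenCreate k * evenCreate l : Module.End ℂ (Fock r Q)) = evenCreate l * evenCreate k := by
  refine end_ext_single fun s => ?_
  simp only [Module.End.mul_apply, evenCreate_single, add_right_comm]

theorem evenDeriv_comm (k l : ModeIdx r) :
    (evenDeriv k * evenDeriv l : Module.End ℂ (Fock r Q)) = evenDeriv l * evenDeriv k := by
  refine end_ext_single fun s => ?_
  simp only [Module.End.mul_apply, evenDeriv_single, tsub_right_comm (b := Finsupp.single l 1)]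
  by_cases h : k = l
  · rw [h]
  · simp [Ne.symm h, h, mul_comm]

theorem evenDeriv_mul_evenCreate (k l : ModeIdx r) :
    (evenDeriv k * evenCreate l : Module.End ℂ (Fock r Q)) =
      evenCreate l * evenDeriv k + (if k = l then 1 else 0 : ℂ) • 1 := by
  refine end_ext_single fun s => ?_
  obtain ⟨ν, F, β⟩ := s
  simp only [Module.End.mul_apply, evenDeriv_single, evenCreate_single, LinearMap.add_apply,
    LinearMap.smul_apply, Module.End.one_apply]
  by_cases h : k = l
  · subst h
    -- Subtraction of exponents is truncated: lowering and then raising restores `ν` only if `ν k >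
    -- 0`; otherwise the coefficient `ν k` kills the term.
    by_cases hk : ν k = 0
    · simp [hk]
    · have : ν - Finsupp.single k 1 + Finsupp.single k 1 = ν :=
        tsub_add_cancel_of_le (by rw [Finsupp.single_le_iff]; omega)
      simp [this, ← Finsupp.single_add]
  · have : ν + Finsupp.single l 1 - Finsupp.single k 1 =
        ν - Finsupp.single k 1 + Finsupp.single l 1 := by
      ext x
      by_cases hx : x = k
      · subst hx; simp [h]
      · simp [Finsupp.single_apply, Ne.symm hx]
    simp [h, this]

/-- For `k ≠ l`, inserting one label changes the sign attached to the other only if the inserted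
label is the smaller. Thus exactly one of the two orders of multiplication acquires an extra sign.
The other relations between odd generators rest on the same comparison. -/
theorem oddCreate_anticomm (k l : ModeIdx r) :
    (oddCreate k * oddCreate l : Module.End ℂ (Fock r Q)) =
      (-1 : ℂ) • (oddCreate l * oddCreate k) := by
  refine end_ext_single fun s => ?_
  obtain ⟨ν, F, β⟩ := s
  simp only [Module.End.mul_apply, oddCreate_single, LinearMap.smul_apply, neg_one_smul]
  by_cases h : k = l
  · subst h
    split_ifs <;> simp [oddCreate_single]
  by_cases hk : k ∈ F <;> by_cases hl : l ∈ F <;>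
    simp only [hk, hl, if_true, if_false, map_zero, neg_zero, oddCreate_single,
      Finset.mem_insert, or_true, h, Ne.symm h, or_self]
  rw [oddSign_insert hk, oddSign_insert hl, Finset.insert_comm, ← Finsupp.single_neg]
  congr 1
  rcases lt_or_gt_of_ne h with h' | h' <;> simp [h', h'.not_gt] <;> ring

theorem oddDeriv_anticomm (k l : ModeIdx r) :
    (oddDeriv k * oddDeriv l : Module.End ℂ (Fock r Q)) =
      (-1 : ℂ) • (oddDeriv l * oddDeriv k) := by
  refine end_ext_single fun s => ?_
  obtain ⟨ν, F, β⟩ := s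
  simp only [Module.End.mul_apply, oddDeriv_single, LinearMap.smul_apply, neg_one_smul]
  by_cases h : k = l
  · subst h
    split_ifs <;> simp [oddDeriv_single]
  by_cases hk : k ∈ F <;> by_cases hl : l ∈ F <;>
    simp only [hk, hl, if_true, if_false, map_zero, neg_zero, oddDeriv_single,
      Finset.mem_erase, h, Ne.symm h, and_self, ne_eq, not_false_eq_true, and_false]
  rw [oddSign_erase hk, oddSign_erase hl, Finset.erase_right_comm, ← Finsupp.single_neg]
  congr 1
  rcases lt_or_gt_of_ne h with h' | h' <;> simp [h', h'.not_gt] <;> ring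

theorem oddDeriv_mul_oddCreate (k l : ModeIdx r) :
    (oddDeriv k * oddCreate l : Module.End ℂ (Fock r Q)) =
      (-1 : ℂ) • (oddCreate l * oddDeriv k) + (if k = l then 1 else 0 : ℂ) • 1 := by
  refine end_ext_single fun s => ?_
  obtain ⟨ν, F, β⟩ := s
  simp only [Module.End.mul_apply, oddDeriv_single, oddCreate_single, LinearMap.add_apply,
    LinearMap.smul_apply, neg_one_smul, Module.End.one_apply]
  by_cases h : k = l
  · subst h
    by_cases hk : k ∈ F
    · simp [hk, oddCreate_single, oddSign_erase, oddSign_mul_self]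
    · simp [hk, oddDeriv_single, oddSign_insert, oddSign_mul_self]
  by_cases hk : k ∈ F <;> by_cases hl : l ∈ F <;>
    simp only [hk, hl, if_true, if_false, map_zero, neg_zero, oddDeriv_single, oddCreate_single,
      Finset.mem_erase, Finset.mem_insert, h, Ne.symm h, and_self, ne_eq, not_false_eq_true,
      and_false, or_self, zero_smul, add_zero, or_true]
  rw [oddSign_erase hk, oddSign_insert hl, Finset.erase_insert_of_ne (Ne.symm h),
    ← Finsupp.single_neg]
  congr 1
  rcases lt_or_gt_of_ne h with h' | h' <;> simp [h', h'.not_gt] <;> ring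

theorem evenCreate_comm_oddCreate (k l : ModeIdx r) :
    (evenCreate k * oddCreate l : Module.End ℂ (Fock r Q)) = oddCreate l * evenCreate k := by
  refine end_ext_single fun s => ?_
  simp only [Module.End.mul_apply, evenCreate_single, oddCreate_single]
  split_ifs <;> simp [evenCreate_single]

theorem evenCreate_comm_oddDeriv (k l : ModeIdx r) :
    (evenCreate k * oddDeriv l : Module.End ℂ (Fock r Q)) = oddDeriv l * evenCreate k := by
  refine end_ext_single fun s => ?_
  simp only [Module.End.mul_apply, evenCreate_single, oddDeriv_single]
  split_ifs <;> simp [evenCreate_single]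

theorem evenDeriv_comm_oddCreate (k l : ModeIdx r) :
    (evenDeriv k * oddCreate l : Module.End ℂ (Fock r Q)) = oddCreate l * evenDeriv k := by
  refine end_ext_single fun s => ?_
  simp only [Module.End.mul_apply, evenDeriv_single, oddCreate_single]
  split_ifs <;> simp [evenDeriv_single, mul_comm]

theorem evenDeriv_comm_oddDeriv (k l : ModeIdx r) :
    (evenDeriv k * oddDeriv l : Module.End ℂ (Fock r Q)) = oddDeriv l * evenDeriv k := by
  refine end_ext_single fun s => ?_
  simp only [Module.End.mul_apply, evenDeriv_single, oddDeriv_single]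
  split_ifs <;> simp [evenDeriv_single, mul_comm]

end CanonicalRelations

/-! ### Commutators of the free modes -/

section ModeRelations

open scoped VertexOperator

variable {r : ℕ} {Q : Type*} [AddCommGroup Q]
  (B : LinearMap.BilinForm ℤ Q) (b : Module.Basis (Fin r) ℤ Q)

/-- The Gram matrix of the lattice. -/
def gramW (k l : Fin r) : ℂ := formW B (toW (b k)) (toW (b l))

theorem formW_toW (α β : Q) : formW B (toW α) (toW β) = (B α β : ℂ) := by
  simp [formW, toW]

theorem formW_symm (hB : B.IsSymm) (h h' : ℂ ⊗[ℤ] Q) : formW B h h' = formW B h' h :=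
  (LinearMap.BilinForm.IsSymm.baseChange ℂ ⟨hB.eq⟩).eq h h'

theorem gramW_symm (hB : B.IsSymm) (k l : Fin r) : gramW B b k l = gramW B b l k :=
  formW_symm B hB (toW (b k)) (toW (b l))

theorem coordW_toW_basis (l i : Fin r) : coordW b (toW (b l)) i = if l = i then 1 else 0 := by
  simp [coordW, toW, Finsupp.single_apply]

theorem sum_coordW_smul (h : ℂ ⊗[ℤ] Q) : ∑ i, coordW b h i • toW (b i) = h := by
  conv_rhs => rw [← (Algebra.TensorProduct.basis ℂ b).sum_repr h]
  simp [coordW, toW]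

theorem formW_eq_sum_left (h h' : ℂ ⊗[ℤ] Q) :
    formW B h h' = ∑ i, coordW b h i * formW B (toW (b i)) h' := by
  conv_lhs => rw [← sum_coordW_smul b h]
  simp

theorem evenMode_zero_single (h : ℂ ⊗[ℤ] Q) (s : FockIdx r Q) (c : ℂ) :
    evenMode B b h 0 (Finsupp.single s c) = formW B h (toW s.2.2) • Finsupp.single s c := by
  change onBasis _ _ = _
  rw [onBasis_single_smul]
  simp [mul_comm]

theorem evenMode_succ (h : ℂ ⊗[ℤ] Q) (m : ℕ) :
    (evenMode B b h ((m : ℤ) + 1) : Module.End ℂ (Fock r Q)) =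
      ((m : ℂ) + 1) • ∑ i, formW B h (toW (b i)) • evenDeriv (toLex (m, i)) := rfl

theorem evenMode_neg (h : ℂ ⊗[ℤ] Q) (m : ℕ) :
    (evenMode B b h (-(m : ℤ) - 1) : Module.End ℂ (Fock r Q)) =
      ∑ i, coordW b h i • evenCreate (toLex (m, i)) := by
  rw [show -(m : ℤ) - 1 = Int.negSucc m by rw [Int.negSucc_eq]; ring]
  rfl

theorem oddMode_natCast (h : ℂ ⊗[ℤ] Q) (m : ℕ) :
    (oddMode B b h (m : ℤ) : Module.End ℂ (Fock r Q)) =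
      ∑ i, formW B h (toW (b i)) • oddDeriv (toLex (m, i)) := rfl

theorem oddMode_neg (h : ℂ ⊗[ℤ] Q) (m : ℕ) :
    (oddMode B b h (-(m : ℤ) - 1) : Module.End ℂ (Fock r Q)) =
      ∑ i, coordW b h i • oddCreate (toLex (m, i)) := by
  rw [show -(m : ℤ) - 1 = Int.negSucc m by rw [Int.negSucc_eq]; ring]
  rfl

theorem evenMode_basis_neg (l : Fin r) (m : ℕ) :
    (evenMode B b (toW (b l)) (-(m : ℤ) - 1) : Module.End ℂ (Fock r Q)) =
      evenCreate (toLex (m, l)) := by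
  simp [evenMode_neg, coordW_toW_basis]

theorem oddMode_basis_neg (l : Fin r) (m : ℕ) :
    (oddMode B b (toW (b l)) (-(m : ℤ) - 1) : Module.End ℂ (Fock r Q)) =
      oddCreate (toLex (m, l)) := by
  simp [oddMode_neg, coordW_toW_basis]

theorem int_cases_neg_zero_succ (n : ℤ) :
    n = 0 ∨ (∃ m : ℕ, n = (m : ℤ) + 1) ∨ ∃ m : ℕ, n = -(m : ℤ) - 1 := by
  rcases lt_trichotomy n 0 with h | h | h
  · exact Or.inr (Or.inr ⟨(-n - 1).toNat, by omega⟩)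
  · exact Or.inl h
  · exact Or.inr (Or.inl ⟨(n - 1).toNat, by omega⟩)

theorem int_cases_neg_natCast (n : ℤ) : (∃ m : ℕ, n = m) ∨ ∃ m : ℕ, n = -(m : ℤ) - 1 := by
  rcases le_or_gt 0 n with h | h
  · exact Or.inl ⟨n.toNat, by omega⟩
  · exact Or.inr ⟨(-n - 1).toNat, by omega⟩

/-- Linearity in `h` reduces the relations to basis vectors `b l`, whose creation modes are single
generators. -/
theorem evenMode_eq_sum (h : ℂ ⊗[ℤ] Q) (n : ℤ) :
    (evenMode B b h n : Module.End ℂ (Fock r Q)) =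
      ∑ l, coordW b h l • evenMode B b (toW (b l)) n := by
  rcases int_cases_neg_zero_succ n with rfl | ⟨m, rfl⟩ | ⟨m, rfl⟩
  · refine end_ext_single fun s => ?_
    simp only [LinearMap.sum_apply, LinearMap.smul_apply, evenMode_zero_single]
    rw [formW_eq_sum_left B b h, Finset.sum_smul]
    simp only [mul_smul]
  · simp only [evenMode_succ]
    simp_rw [formW_eq_sum_left B b h, Finset.sum_smul, Finset.smul_sum]
    rw [Finset.sum_comm]
    refine Finset.sum_congr rfl fun l _ => Finset.sum_congr rfl fun i _ => ?_
    module
  · simp only [evenMode_basis_neg]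
    exact evenMode_neg B b h m

theorem oddMode_eq_sum (h : ℂ ⊗[ℤ] Q) (n : ℤ) :
    (oddMode B b h n : Module.End ℂ (Fock r Q)) =
      ∑ l, coordW b h l • oddMode B b (toW (b l)) n := by
  rcases int_cases_neg_natCast n with ⟨m, rfl⟩ | ⟨m, rfl⟩
  · simp only [oddMode_natCast]
    simp_rw [formW_eq_sum_left B b h, Finset.sum_smul, Finset.smul_sum]
    rw [Finset.sum_comm]
    refine Finset.sum_congr rfl fun l _ => Finset.sum_congr rfl fun i _ => ?_
    module
  · simp only [oddMode_basis_neg]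
    exact oddMode_neg B b h m

/-- The zero mode is diagonal and its eigenvalue depends on the lattice label alone, so it commutes
with any operator taking basis vectors to multiples of basis vectors with the same label. -/
theorem commute_evenMode_zero {h : ℂ ⊗[ℤ] Q} {X : Module.End ℂ (Fock r Q)}
    (hX : ∀ s, ∃ s' c, X (Finsupp.single s 1) = Finsupp.single s' c ∧ s'.2.2 = s.2.2) :
    Commute (evenMode B b h 0) X := by
  refine end_ext_single fun s => ?_
  obtain ⟨s', c, h1, h2⟩ := hX s
  rw [Module.End.mul_apply, Module.End.mul_apply, evenMode_zero_single, map_smul, h1,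
    evenMode_zero_single, h2]

theorem commute_evenMode_zero_evenCreate (h : ℂ ⊗[ℤ] Q) (k : ModeIdx r) :
    Commute (evenMode B b h 0) (evenCreate k) :=
  commute_evenMode_zero B b fun s => ⟨_, _, evenCreate_single k s 1, rfl⟩

theorem commute_evenMode_zero_evenDeriv (h : ℂ ⊗[ℤ] Q) (k : ModeIdx r) :
    Commute (evenMode B b h 0) (evenDeriv k) :=
  commute_evenMode_zero B b fun s => ⟨_, _, evenDeriv_single k s 1, rfl⟩

theorem commute_evenMode_zero_oddCreate (h : ℂ ⊗[ℤ] Q) (k : ModeIdx r) :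
    Commute (evenMode B b h 0) (oddCreate k) :=
  commute_evenMode_zero B b fun s => by
    rw [oddCreate_single]
    split_ifs
    · exact ⟨s, 0, by simp, rfl⟩
    · exact ⟨_, _, rfl, rfl⟩

theorem commute_evenMode_zero_oddDeriv (h : ℂ ⊗[ℤ] Q) (k : ModeIdx r) :
    Commute (evenMode B b h 0) (oddDeriv k) :=
  commute_evenMode_zero B b fun s => by
    rw [oddDeriv_single]
    split_ifs
    · exact ⟨_, _, rfl, rfl⟩
    · exact ⟨s, 0, by simp, rfl⟩

theorem commute_evenMode_oddMode (h h' : ℂ ⊗[ℤ] Q) (m n : ℤ) :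
    Commute (evenMode B b h m : Module.End ℂ (Fock r Q)) (oddMode B b h' n) := by
  rcases int_cases_neg_zero_succ m with rfl | ⟨m, rfl⟩ | ⟨m, rfl⟩ <;>
  rcases int_cases_neg_natCast n with ⟨n, rfl⟩ | ⟨n, rfl⟩ <;>
  simp only [evenMode_succ, evenMode_neg, oddMode_neg, oddMode_natCast]
  · exact Commute.sum_right _ _ _ fun i _ => (commute_evenMode_zero_oddDeriv B b h _).smul_right _
  · exact Commute.sum_right _ _ _ fun i _ => (commute_evenMode_zero_oddCreate B b h _).smul_right _
  · exact (Commute.sum_left _ _ _ fun i _ => Commute.sum_right _ _ _ fun j _ =>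
      (Commute.smul_right (evenDeriv_comm_oddDeriv _ _) _).smul_left _).smul_left _
  · exact (Commute.sum_left _ _ _ fun i _ => Commute.sum_right _ _ _ fun j _ =>
      (Commute.smul_right (evenDeriv_comm_oddCreate _ _) _).smul_left _).smul_left _
  · exact Commute.sum_left _ _ _ fun i _ => Commute.sum_right _ _ _ fun j _ =>
      (Commute.smul_right (evenCreate_comm_oddDeriv _ _) _).smul_left _
  · exact Commute.sum_left _ _ _ fun i _ => Commute.sum_right _ _ _ fun j _ =>
      (Commute.smul_right (evenCreate_comm_oddCreate _ _) _).smul_left _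

theorem evenMode_succ_mul_evenMode_neg (k l : Fin r) (m n : ℕ) :
    (evenMode B b (toW (b k)) ((m : ℤ) + 1) * evenMode B b (toW (b l)) (-(n : ℤ) - 1) :
        Module.End ℂ (Fock r Q)) =
      evenMode B b (toW (b l)) (-(n : ℤ) - 1) * evenMode B b (toW (b k)) ((m : ℤ) + 1) +
        (if m = n then ((m : ℂ) + 1) * gramW B b k l else 0) • 1 := by
  rw [evenMode_basis_neg, evenMode_succ, smul_mul_assoc, mul_smul_comm, Finset.sum_mul,
    Finset.mul_sum]
  simp only [smul_mul_assoc, mul_smul_comm, evenDeriv_mul_evenCreate, smul_add,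
    Finset.sum_add_distrib, smul_smul]
  rw [← Finset.sum_smul, smul_smul]
  congr 2
  by_cases h : m = n <;> simp [h, gramW]

theorem oddMode_natCast_mul_oddMode_neg (k l : Fin r) (m n : ℕ) :
    (oddMode B b (toW (b k)) (m : ℤ) * oddMode B b (toW (b l)) (-(n : ℤ) - 1) :
        Module.End ℂ (Fock r Q)) =
      (-1 : ℂ) • (oddMode B b (toW (b l)) (-(n : ℤ) - 1) * oddMode B b (toW (b k)) (m : ℤ)) +
        (if m = n then gramW B b k l else 0) • 1 := by
  rw [oddMode_basis_neg, oddMode_natCast, Finset.sum_mul, Finset.mul_sum]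
  simp only [smul_mul_assoc, mul_smul_comm, oddDeriv_mul_oddCreate, smul_add,
    Finset.sum_add_distrib, smul_smul, Finset.smul_sum]
  rw [← Finset.sum_smul]
  congr 2
  · simp only [mul_comm]
  by_cases h : m = n <;> simp [h, gramW]

theorem evenMode_mul_evenMode (hB : B.IsSymm) (k l : Fin r) (m n : ℤ) :
    (evenMode B b (toW (b k)) m * evenMode B b (toW (b l)) n : Module.End ℂ (Fock r Q)) =
      evenMode B b (toW (b l)) n * evenMode B b (toW (b k)) m +
        (if n = -m then (m : ℂ) * gramW B b k l else 0) • 1 := by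
  rcases int_cases_neg_zero_succ m with rfl | ⟨m, rfl⟩ | ⟨m, rfl⟩ <;>
  rcases int_cases_neg_zero_succ n with rfl | ⟨n, rfl⟩ | ⟨n, rfl⟩
  · have : Commute (evenMode B b (toW (b k)) 0 : Module.End ℂ (Fock r Q))
        (evenMode B b (toW (b l)) 0) :=
      commute_evenMode_zero B b fun s => ⟨s, formW B (toW (b l)) (toW s.2.2), by
        rw [evenMode_zero_single, Finsupp.smul_single_one], rfl⟩
    simp [this.eq]
  · rw [if_neg (by omega), zero_smul, add_zero, evenMode_succ]
    exact (Commute.sum_right _ _ _ fun i _ =>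
      (commute_evenMode_zero_evenDeriv B b _ _).smul_right _).smul_right _
  · rw [if_neg (by omega), zero_smul, add_zero, evenMode_neg]
    exact Commute.sum_right _ _ _ fun i _ =>
      (commute_evenMode_zero_evenCreate B b _ _).smul_right _
  · rw [if_neg (by omega), zero_smul, add_zero, evenMode_succ]
    exact (Commute.sum_left _ _ _ fun i _ =>
      (commute_evenMode_zero_evenDeriv B b _ _).symm.smul_left _).smul_left _
  · rw [if_neg (by omega), zero_smul, add_zero, evenMode_succ, evenMode_succ]
    exact ((Commute.sum_left _ _ _ fun i _ => Commute.sum_right _ _ _ fun j _ =>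
      (Commute.smul_right (evenDeriv_comm _ _) _).smul_left _).smul_left _).smul_right _
  · rw [evenMode_succ_mul_evenMode_neg]
    congr 2
    refine if_congr (by omega) (by push_cast; ring) rfl
  · rw [if_neg (by omega), zero_smul, add_zero, evenMode_neg]
    exact Commute.sum_left _ _ _ fun i _ =>
      (commute_evenMode_zero_evenCreate B b _ _).symm.smul_left _
  · rw [evenMode_succ_mul_evenMode_neg, add_assoc, ← add_smul, gramW_symm B b hB l k]
    by_cases h : n = m
    · subst h
      rw [if_pos rfl, if_pos (by ring)]
      push_cast
      module
    · rw [if_neg h, if_neg (by omega)]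
      simp
  · rw [if_neg (by omega), zero_smul, add_zero, evenMode_neg, evenMode_neg]
    exact Commute.sum_left _ _ _ fun i _ => Commute.sum_right _ _ _ fun j _ =>
      (Commute.smul_right (evenCreate_comm _ _) _).smul_left _

theorem oddMode_mul_oddMode (hB : B.IsSymm) (k l : Fin r) (m n : ℤ) :
    (oddMode B b (toW (b k)) m * oddMode B b (toW (b l)) n : Module.End ℂ (Fock r Q)) =
      (-1 : ℂ) • (oddMode B b (toW (b l)) n * oddMode B b (toW (b k)) m) +
        (if n = -m - 1 then gramW B b k l else 0) • 1 := by
  rcases int_cases_neg_natCast m with ⟨m, rfl⟩ | ⟨m, rfl⟩ <;>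
  rcases int_cases_neg_natCast n with ⟨n, rfl⟩ | ⟨n, rfl⟩
  · rw [if_neg (by omega), zero_smul, add_zero]
    simp only [oddMode_natCast, Finset.sum_mul, Finset.mul_sum, smul_mul_assoc, mul_smul_comm,
      Finset.smul_sum]
    rw [Finset.sum_comm]
    refine Finset.sum_congr rfl fun i _ => Finset.sum_congr rfl fun j _ => ?_
    rw [oddDeriv_anticomm]
    module
  · rw [oddMode_natCast_mul_oddMode_neg]
    congr 2
    exact if_congr (by omega) rfl rfl
  · rw [oddMode_natCast_mul_oddMode_neg, gramW_symm B b hB l k]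
    by_cases h : n = m
    · subst h
      rw [if_pos rfl, if_pos (by ring)]
      module
    · rw [if_neg h, if_neg (by omega)]
      module
  · rw [if_neg (by omega), zero_smul, add_zero, oddMode_basis_neg, oddMode_basis_neg,
      oddCreate_anticomm]

theorem evenField_ncoeff (h : ℂ ⊗[ℤ] Q) (n : ℤ) :
    (evenField B b h)[[n]] = evenMode B b h n := ofModes_ncoeff _ _ n

theorem oddField_ncoeff (h : ℂ ⊗[ℤ] Q) (n : ℤ) :
    (oddField B b h)[[n]] = oddMode B b h n := ofModes_ncoeff _ _ n

end ModeRelations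

/-! ### The modes of `G`: brackets with free modes, and the identification with `S` -/

section Superconformal

open scoped VertexOperator

theorem exists_nat_bound {V ι : Type*} [AddCommGroup V] [Module ℂ V] [Fintype ι]
    (A : ι → VertexOperator ℂ V) (v : V) :
    ∃ N : ℕ, ∀ l, ∀ j : ℤ, N ≤ j → ((A l)[[j]]) v = 0 := by
  choose K hK using fun l => exists_ncoeff_eq_zero (A l) v
  refine ⟨Finset.univ.sup fun l => (K l).toNat, fun l j hj => hK l j ?_⟩
  have : (K l).toNat ≤ Finset.univ.sup fun l => (K l).toNat :=
    Finset.le_sup (f := fun l => (K l).toNat) (Finset.mem_univ l)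
  omega

variable {r : ℕ} {Q : Type*} [AddCommGroup Q]
  (B : LinearMap.BilinForm ℤ Q) (b : Module.Basis (Fin r) ℤ Q) (c : Fin r → Fin r → ℂ)

/-- The modes of the field `∑ c_{lm} :(S b_l)(z) b_m(z):`. -/
def modeG (n : ℤ) : Module.End ℂ (Fock r Q) :=
  ∑ l, ∑ m, c l m • nopMode 1 (evenField B b (toW (b l))) (oddField B b (toW (b m))) n

/-- `c` is the inverse of the Gram matrix. -/
structure IsInvGram : Prop where
  symm : ∀ l m, c l m = c m l
  gram_mul : ∀ k m, ∑ l, gramW B b k l * c l m = if k = m then 1 else 0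

variable {B b c}

theorem IsInvGram.mul_gram (hc : IsInvGram B b c) (hB : B.IsSymm) (l k : Fin r) :
    ∑ m, c l m * gramW B b m k = if l = k then 1 else 0 := by
  rw [show (if l = k then (1 : ℂ) else 0) = if k = l then 1 else 0 from
    if_congr eq_comm rfl rfl, ← hc.gram_mul k l]
  refine Finset.sum_congr rfl fun m _ => ?_
  rw [hc.symm, gramW_symm B b hB, mul_comm]

/-- This contraction is what makes a bracket with `G` return the vector it started from. -/
theorem IsInvGram.sum_smul_right {M : Type*} [AddCommGroup M] [Module ℂ M]
    (hc : IsInvGram B b c) (k : Fin r) (f : Fin r → M) :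
    ∑ l, ∑ m, (c l m * gramW B b k l) • f m = f k := by
  rw [Finset.sum_comm]
  simp only [← Finset.sum_smul, mul_comm (c _ _), hc.gram_mul]
  simp

theorem IsInvGram.sum_smul_left {M : Type*} [AddCommGroup M] [Module ℂ M]
    (hc : IsInvGram B b c) (hB : B.IsSymm) (k : Fin r) (f : Fin r → M) :
    ∑ l, ∑ m, (c l m * gramW B b m k) • f l = f k := by
  simp only [← Finset.sum_smul, hc.mul_gram hB]
  simp

theorem IsInvGram.sum_mul_formW (hc : IsInvGram B b c) (hB : B.IsSymm) (h : ℂ ⊗[ℤ] Q) (m : Fin r) :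
    ∑ l, c l m * formW B (toW (b l)) h = coordW b h m := by
  have : ∀ l, formW B (toW (b l)) h = ∑ i, coordW b h i * gramW B b l i := fun l => by
    conv_lhs => rw [← sum_coordW_smul b h]
    simp [gramW]
  simp only [this, Finset.mul_sum]
  rw [Finset.sum_comm]
  have key : ∀ i, ∑ l, c l m * (coordW b h i * gramW B b l i) =
      coordW b h i * ∑ l, c m l * gramW B b l i := fun i => by
    rw [Finset.mul_sum]
    refine Finset.sum_congr rfl fun l _ => ?_
    rw [hc.symm l m]
    ring
  simp [key, hc.mul_gram hB]

theorem evenMode_mul_modeG (hB : B.IsSymm) (hc : IsInvGram B b c) (k : Fin r) (m n : ℤ) :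
    evenMode B b (toW (b k)) m * modeG B b c n =
      modeG B b c n * evenMode B b (toW (b k)) m + (m : ℂ) • oddMode B b (toW (b k)) (n - 1 + m) := by
  have key : ∀ l l', evenMode B b (toW (b k)) m *
      nopMode 1 (evenField B b (toW (b l))) (oddField B b (toW (b l'))) n =
      nopMode 1 (evenField B b (toW (b l))) (oddField B b (toW (b l'))) n *
        evenMode B b (toW (b k)) m +
        ((m : ℂ) * gramW B b k l) • oddMode B b (toW (b l')) (n - 1 + m) := fun l l' => by
    -- The bracket of the even mode with `(S b_l)(z)` is the scalar field `m (b_k, b_l) z^(m-1)`;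
    -- with the odd field it is zero.
    rw [mul_nopMode (s := 1) (t := 1) 1 (one_mul 1)
      (A' := constField _ (-m) ((m : ℂ) * gramW B b k l)) (B' := constField _ 0 0)
      (fun j => ?_) (fun j => ?_)]
    · simp only [mul_one, one_smul]
      rw [nopMode_constField_left, nopMode_constField_right, zero_smul, add_zero,
        oddField_ncoeff, sub_neg_eq_add]
    · rw [evenField_ncoeff, evenMode_mul_evenMode B b hB, constField_ncoeff, one_smul]
      split_ifs <;> simp
    · rw [oddField_ncoeff, (commute_evenMode_oddMode B b _ _ _ _).eq, constField_ncoeff]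
      simp
  simp only [modeG, Finset.mul_sum, Finset.sum_mul, mul_smul_comm, smul_mul_assoc, key, smul_add,
    Finset.sum_add_distrib]
  congr 1
  rw [← hc.sum_smul_right k fun l' => (m : ℂ) • oddMode B b (toW (b l')) (n - 1 + m)]
  refine Finset.sum_congr rfl fun l _ => Finset.sum_congr rfl fun l' _ => ?_
  module

theorem oddMode_mul_modeG (hB : B.IsSymm) (hc : IsInvGram B b c) (k : Fin r) (m n : ℤ) :
    oddMode B b (toW (b k)) m * modeG B b c n =
      (-1 : ℂ) • (modeG B b c n * oddMode B b (toW (b k)) m) + evenMode B b (toW (b k)) (n + m) := by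
  have key : ∀ l l', oddMode B b (toW (b k)) m *
      nopMode 1 (evenField B b (toW (b l))) (oddField B b (toW (b l'))) n =
      (-1 : ℂ) • (nopMode 1 (evenField B b (toW (b l))) (oddField B b (toW (b l'))) n *
        oddMode B b (toW (b k)) m) +
        (gramW B b k l') • evenMode B b (toW (b l)) (n + m) := fun l l' => by
    -- The odd mode commutes with the even current; its anticommutator with `b_{l'}(z)` is the
    -- scalar field `(b_k, b_{l'}) z^m`.
    rw [mul_nopMode (s := 1) (t := -1) 1 (one_mul 1)
      (A' := constField _ 0 0) (B' := constField _ (-m - 1) (gramW B b k l'))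
      (fun j => ?_) (fun j => ?_)]
    · have h0 : nopMode (1 * -1) (constField (Fock r Q) 0 0) (oddField B b (toW (b l'))) n = 0 := by
        refine LinearMap.ext fun v => ?_
        simp [nopMode_apply, constField_ncoeff]
      simp only [one_mul, mul_one, one_smul] at h0 ⊢
      rw [h0, nopMode_constField_right, add_zero,
        evenField_ncoeff, show n - 1 - (-m - 1) = n + m by ring]
    · rw [evenField_ncoeff, (commute_evenMode_oddMode B b _ _ _ _).eq, constField_ncoeff]
      simp
    · rw [oddField_ncoeff, oddMode_mul_oddMode B b hB, constField_ncoeff]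
      split_ifs <;> simp
  simp only [modeG, Finset.mul_sum, Finset.sum_mul, mul_smul_comm, smul_mul_assoc, key, smul_add,
    Finset.sum_add_distrib, Finset.smul_sum]
  congr 1
  · refine Finset.sum_congr rfl fun l _ => Finset.sum_congr rfl fun l' _ => ?_
    module
  · rw [← hc.sum_smul_left hB k fun l => evenMode B b (toW (b l)) (n + m)]
    refine Finset.sum_congr rfl fun l _ => Finset.sum_congr rfl fun l' _ => ?_
    rw [gramW_symm B b hB k l']
    module

theorem finsum_nat_eq_sum_range {M : Type*} [AddCommMonoid M] {f : ℕ → M} {N : ℕ}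
    (h : ∀ j, N ≤ j → f j = 0) : ∑ᶠ j, f j = ∑ j ∈ Finset.range N, f j :=
  finsum_eq_sum_of_support_subset _ fun j hj => by
    rw [Finset.coe_range, Set.mem_Iio]
    by_contra hlt
    exact hj (h j (by omega))

theorem sum_evenMode_neg_mul_oddMode (hB : B.IsSymm) (hc : IsInvGram B b c) (j : ℕ) :
    ∑ l, ∑ m, c l m • (evenMode B b (toW (b l)) (-(j : ℤ) - 1) *
      oddMode B b (toW (b m)) (j : ℤ) : Module.End ℂ (Fock r Q)) =
      ∑ l, evenCreate (toLex (j, l)) * oddDeriv (toLex (j, l)) := by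
  simp only [evenMode_basis_neg, oddMode_natCast, Finset.mul_sum, mul_smul_comm, Finset.smul_sum]
  refine Finset.sum_congr rfl fun l _ => ?_
  rw [Finset.sum_comm]
  simp only [smul_smul, ← Finset.sum_smul]
  have : ∀ i, ∑ m, c l m * formW B (toW (b m)) (toW (b i)) = if l = i then 1 else 0 :=
    hc.mul_gram hB l
  simp [this]

theorem sum_oddMode_neg_mul_evenMode_succ (hB : B.IsSymm) (hc : IsInvGram B b c) (j : ℕ) :
    ∑ l, ∑ m, c l m • (oddMode B b (toW (b m)) (-((j + 1 : ℕ) : ℤ) - 1) *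
      evenMode B b (toW (b l)) ((j + 1 : ℕ) : ℤ) : Module.End ℂ (Fock r Q)) =
      ((j : ℂ) + 1) • ∑ l, oddCreate (toLex (j + 1, l)) * evenDeriv (toLex (j, l)) := by
  rw [Nat.cast_succ j]
  simp only [evenMode_succ]
  rw [← Nat.cast_succ j]
  simp only [oddMode_basis_neg, Finset.mul_sum, mul_smul_comm, Finset.smul_sum]
  rw [Finset.sum_comm]
  refine Finset.sum_congr rfl fun m _ => ?_
  rw [Finset.sum_comm]
  have h1 : ∀ i, ∑ l, c l m * formW B (toW (b l)) (toW (b i)) = if i = m then 1 else 0 :=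
    fun i => by rw [hc.sum_mul_formW hB, coordW_toW_basis]
  have h2 : ∀ i, ∑ l, c l m • ((j : ℂ) + 1) • formW B (toW (b l)) (toW (b i)) •
      (oddCreate (toLex (j + 1, m)) * evenDeriv (toLex (j, i)) : Module.End ℂ (Fock r Q)) =
      (if i = m then 1 else 0 : ℂ) • ((j : ℂ) + 1) •
        (oddCreate (toLex (j + 1, m)) * evenDeriv (toLex (j, i))) := fun i => by
    rw [← h1, Finset.sum_smul]
    refine Finset.sum_congr rfl fun l _ => ?_
    module
  simp only [h2]
  simp

theorem sum_oddMode_neg_mul_evenMode_zero (hB : B.IsSymm) (hc : IsInvGram B b c) (s : FockIdx r Q) :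
    ∑ l, ∑ m, c l m • oddMode B b (toW (b m)) (-1)
      (evenMode B b (toW (b l)) 0 (Finsupp.single s 1)) =
      oddMode B b (toW s.2.2) (-1) (Finsupp.single s 1) := by
  rw [oddMode_eq_sum B b (toW s.2.2)]
  simp only [evenMode_zero_single, map_smul, LinearMap.sum_apply, LinearMap.smul_apply]
  rw [Finset.sum_comm]
  refine Finset.sum_congr rfl fun m _ => ?_
  simp only [smul_smul, ← Finset.sum_smul, hc.sum_mul_formW hB]

/-- The three sums defining `opS` are the three kinds of terms in mode `0` of the normally ordered
product: an even annihilator of positive index followed by an odd creator, an odd annihilator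
followed by an even creator, and the zero mode, which reads off the charge `β` and produces
`β_(-1|1)`. Contraction with the inverse Gram matrix turns pairings into coordinates. -/
theorem modeG_zero (hB : B.IsSymm) (hc : IsInvGram B b c) : modeG B b c 0 = opS B b := by
  refine end_ext_single fun s => ?_
  set v : Fock r Q := Finsupp.single s 1 with hv
  obtain ⟨N₁, h₁⟩ := exists_nat_bound (fun l => evenField B b (toW (b l))) v
  obtain ⟨N₂, h₂⟩ := exists_nat_bound (fun l => oddField B b (toW (b l))) v
  obtain ⟨N₃, h₃⟩ := exists_bound s.1.support
  obtain ⟨N₄, h₄⟩ := exists_bound s.2.1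
  simp only [evenField_ncoeff, oddField_ncoeff] at h₁ h₂
  set N := N₁ + N₂ + N₃ + N₄
  have hnop : ∀ l m, nopMode 1 (evenField B b (toW (b l))) (oddField B b (toW (b m))) 0 v =
      (∑ j ∈ Finset.range N, evenMode B b (toW (b l)) (-(j : ℤ) - 1)
        (oddMode B b (toW (b m)) (j : ℤ) v)) +
      ((∑ j ∈ Finset.range N, oddMode B b (toW (b m)) (-((j + 1 : ℕ) : ℤ) - 1)
        (evenMode B b (toW (b l)) ((j + 1 : ℕ) : ℤ) v)) +
        oddMode B b (toW (b m)) (-1) (evenMode B b (toW (b l)) 0 v)) := fun l m => by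
    simp only [nopMode_apply, evenField_ncoeff, oddField_ncoeff, zero_add, one_smul, zero_sub]
    -- The second sum is cut at `N + 1` so that splitting off its zero-mode term `j = 0` leaves a
    -- sum over `range N` as well.
    rw [finsum_nat_eq_sum_range (N := N) fun j hj => by rw [h₂ m _ (by omega), map_zero],
      finsum_nat_eq_sum_range (N := N + 1) fun j hj => by rw [h₁ l _ (by omega), map_zero],
      Finset.sum_range_succ']
    rfl
  have hfin : ∀ f : ModeIdx r → Fock r Q, ∀ t : Finset (ModeIdx r),
      (∀ k ∈ t, (ofLex k).1 < N) → (∀ k, k ∉ t → f k = 0) →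
      ∑ j ∈ Finset.range N, ∑ l, f (toLex (j, l)) = ∑ k ∈ t, f k := fun f t ht hf => by
    rw [← Finset.sum_product']
    refine (Finset.sum_map (Finset.range N ×ˢ Finset.univ)
      (toLex (α := ℕ × Fin r)).toEmbedding f).symm.trans ?_
    refine (Finset.sum_subset (fun k hk => ?_) fun k _ hk => hf k hk).symm
    rw [Finset.mem_map]
    exact ⟨ofLex k, by simpa using ht k hk, rfl⟩
  simp only [modeG, LinearMap.sum_apply, LinearMap.smul_apply, hnop, smul_add,
    Finset.sum_add_distrib]
  rw [sum_oddMode_neg_mul_evenMode_zero hB hc s, opS, onBasis_single, ← add_assoc]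
  congr 1
  rw [add_comm]
  congr 1
  · have e : ∀ j ∈ Finset.range N, ∑ l, ∑ m, c l m • oddMode B b (toW (b m))
        (-((j + 1 : ℕ) : ℤ) - 1) (evenMode B b (toW (b l)) ((j + 1 : ℕ) : ℤ) v) =
        ∑ l, ((j : ℂ) + 1) • oddCreate (toLex (j + 1, l)) (evenDeriv (toLex (j, l)) v) :=
      fun j _ => by
        simpa [Finset.smul_sum] using
          LinearMap.congr_fun (sum_oddMode_neg_mul_evenMode_succ (Q := Q) hB hc j) v
    simp only [Finset.smul_sum]
    rw [Finset.sum_congr rfl fun l _ => Finset.sum_comm, Finset.sum_comm, Finset.sum_congr rfl e]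
    refine hfin (fun k => (((ofLex k).1 : ℂ) + 1) •
      oddCreate (toLex ((ofLex k).1 + 1, (ofLex k).2)) (evenDeriv k v)) s.1.support
      (fun k hk => (h₃ k hk).trans_le (by omega)) fun k hk => ?_
    rw [hv, evenDeriv_eq_zero s k (by simpa using hk), map_zero, smul_zero]
  · have e : ∀ j ∈ Finset.range N, ∑ l, ∑ m, c l m • evenMode B b (toW (b l)) (-(j : ℤ) - 1)
        (oddMode B b (toW (b m)) (j : ℤ) v) =
        ∑ l, evenCreate (toLex (j, l)) (oddDeriv (toLex (j, l)) v) :=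
      fun j _ => by
        simpa using LinearMap.congr_fun (sum_evenMode_neg_mul_oddMode (Q := Q) hB hc j) v
    simp only [Finset.smul_sum]
    rw [Finset.sum_congr rfl fun l _ => Finset.sum_comm, Finset.sum_comm, Finset.sum_congr rfl e]
    refine hfin (fun k => evenCreate k (oddDeriv k v)) s.2.1
      (fun k hk => (h₄ k hk).trans_le (by omega)) fun k hk => ?_
    rw [hv, oddDeriv_eq_zero s k hk, map_zero]

theorem opS_mul_evenMode (hB : B.IsSymm) (hc : IsInvGram B b c) (k : Fin r) (m : ℤ) :
    opS B b * evenMode B b (toW (b k)) m = evenMode B b (toW (b k)) m * opS B b +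
      (-(m : ℂ)) • oddMode B b (toW (b k)) (m - 1) := by
  rw [← modeG_zero hB hc, evenMode_mul_modeG hB hc, show (0 : ℤ) - 1 + m = m - 1 by ring]
  module

theorem opS_mul_oddMode (hB : B.IsSymm) (hc : IsInvGram B b c) (k : Fin r) (m : ℤ) :
    opS B b * oddMode B b (toW (b k)) m = (-1 : ℂ) • (oddMode B b (toW (b k)) m * opS B b) +
      evenMode B b (toW (b k)) m := by
  rw [← modeG_zero hB hc, oddMode_mul_modeG hB hc, zero_add]
  module

/-- The modes of the field `∑ c_{lm} (:(S b_l)(z) (S b_m)(z): - :b_m(z) ∂b_l(z):)`. -/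
def modeL (B : LinearMap.BilinForm ℤ Q) (b : Module.Basis (Fin r) ℤ Q) (c : Fin r → Fin r → ℂ)
    (n : ℤ) : Module.End ℂ (Fock r Q) :=
  ∑ l, ∑ m, c l m • (nopMode 1 (evenField B b (toW (b l))) (evenField B b (toW (b m))) n +
    (-1 : ℂ) • nopMode (-1) (oddField B b (toW (b m))) (fieldDeriv (oddField B b (toW (b l)))) n)

theorem nopMode_evenField_swap (hB : B.IsSymm) (k l : Fin r) (n : ℤ) :
    nopMode 1 (evenField B b (toW (b k))) (evenField B b (toW (b l))) n =
      nopMode 1 (evenField B b (toW (b l))) (evenField B b (toW (b k))) n := by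
  refine nopMode_swap fun j => ?_
  simp only [evenField_ncoeff]
  rw [evenMode_mul_evenMode B b hB]
  -- Two even modes of total index `n - 1` fail to commute only if `n = 1` and `j ≠ 0`, and then
  -- both products already place the mode of negative index on the left.
  by_cases h : n = 1 ∧ j ≠ 0
  · left
    omega
  · right
    split_ifs with hj
    · obtain rfl : j = 0 := by omega
      simp
    · simp

/-- `S` sends `b_m(z)` to `(S b_m)(z)` and `(S b_l)(z)` to `∂b_l(z)`. The factors are swapped first,
so that the derivation rule produces `:b_m ∂b_l:` in the order used by `modeL`. -/
theorem modeL_eq (hB : B.IsSymm) (hc : IsInvGram B b c) (n : ℤ) :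
    modeL B b c n = opS B b * modeG B b c n + modeG B b c n * opS B b := by
  have key : ∀ l m, opS B b *
      nopMode 1 (evenField B b (toW (b l))) (oddField B b (toW (b m))) n =
      (-1 : ℂ) • (nopMode 1 (evenField B b (toW (b l))) (oddField B b (toW (b m))) n *
        opS B b) + (nopMode 1 (evenField B b (toW (b l))) (evenField B b (toW (b m))) n +
        (-1 : ℂ) • nopMode (-1) (oddField B b (toW (b m)))
          (fieldDeriv (oddField B b (toW (b l)))) n) := fun l m => by
    rw [nopMode_swap fun j => Or.inr (by
      rw [evenField_ncoeff, oddField_ncoeff]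
      exact (commute_evenMode_oddMode B b _ _ _ _).eq),
      mul_nopMode (s := -1) (t := 1) 1 (by norm_num)
      (A' := evenField B b (toW (b m))) (B' := fieldDeriv (oddField B b (toW (b l))))
      (fun j => ?_) (fun j => ?_)]
    · simp only [one_mul, mul_one]
      rw [nopMode_evenField_swap hB m l, add_assoc]
    · rw [evenField_ncoeff, oddField_ncoeff, opS_mul_oddMode hB hc]
    · rw [fieldDeriv_ncoeff, evenField_ncoeff, oddField_ncoeff, opS_mul_evenMode hB hc, one_smul]
  simp only [modeL, modeG, Finset.mul_sum, Finset.sum_mul, mul_smul_comm, smul_mul_assoc, key,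
    ← Finset.sum_add_distrib]
  refine Finset.sum_congr rfl fun l _ => Finset.sum_congr rfl fun m _ => ?_
  module

/-- The super Jacobi identity `[{S, G}, E] = {S, [G, E]} + {[S, E], G}`: each term on the right
contributes `-m E₁`. -/
theorem anticommutator_mul_even {R : Type*} [Ring R] [Algebra ℂ R] {S G E O O' E₁ : R} {m : ℂ}
    (h₁ : E * G = G * E + m • O) (h₂ : S * E = E * S + (-m) • O')
    (h₃ : O' * G = (-1 : ℂ) • (G * O') + E₁) (h₄ : S * O = (-1 : ℂ) • (O * S) + E₁) :
    (S * G + G * S) * E = E * (S * G + G * S) + (-(2 * m)) • E₁ := by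
  have h₁' : G * E = E * G - m • O := by rw [h₁]; abel
  have a₁ : S * (G * E) = S * E * G - m • (S * O) := by
    rw [h₁', mul_sub, mul_smul_comm, mul_assoc]
  have a₂ : G * (S * E) = G * E * S - m • (G * O') := by
    rw [h₂, mul_add, mul_smul_comm, mul_assoc]
    module
  rw [add_mul, mul_assoc, mul_assoc, a₁, a₂, h₄, h₂, h₁']
  simp only [mul_add, add_mul, sub_mul, smul_mul_assoc, mul_assoc, h₃]
  module

/-- The super Jacobi identity `[{S, G}, O] = [S, {G, O}] + [G, {S, O}]`, whose terms on the right
are `-k O₁` and `-m O₁`. -/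
theorem anticommutator_mul_odd {R : Type*} [Ring R] [Algebra ℂ R] {S G O E E' O₁ : R} {m k t : ℂ}
    (h₁ : O * G = (-1 : ℂ) • (G * O) + E') (h₂ : S * O = (-1 : ℂ) • (O * S) + E)
    (h₃ : E * G = G * E + m • O₁) (h₄ : S * E' = E' * S + (-k) • O₁)
    (ht : t = -(k + m)) :
    (S * G + G * S) * O = O * (S * G + G * S) + t • O₁ := by
  have h₁' : G * O = E' - O * G := by rw [h₁]; module
  calc (S * G + G * S) * O = S * (G * O) + G * (S * O) := by simp only [add_mul, mul_assoc]
    _ = S * E' - (S * O) * G + (G * E - (G * O) * S) := by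
      rw [h₁', h₂]
      simp only [mul_add, mul_sub, mul_smul_comm, add_mul, sub_mul, smul_mul_assoc]
      rw [← mul_assoc S O G, ← mul_assoc G O S, h₁', h₂]
      simp only [add_mul, sub_mul, smul_mul_assoc]
      module
    _ = _ := by
      rw [h₄, h₂, h₁', ht]
      simp only [mul_add, add_mul, sub_mul, smul_mul_assoc, mul_assoc, h₃]
      module

theorem modeL_mul_evenMode (hB : B.IsSymm) (hc : IsInvGram B b c) (k : Fin r) (m n : ℤ) :
    modeL B b c n * evenMode B b (toW (b k)) m =
      evenMode B b (toW (b k)) m * modeL B b c n +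
        (-(2 * (m : ℂ))) • evenMode B b (toW (b k)) (n - 1 + m) := by
  have h := oddMode_mul_modeG hB hc k (m - 1) n
  rw [show n + (m - 1) = n - 1 + m by ring] at h
  rw [modeL_eq hB hc]
  exact anticommutator_mul_even (R := Module.End ℂ (Fock r Q)) (evenMode_mul_modeG hB hc k m n)
    (opS_mul_evenMode hB hc k m) h (opS_mul_oddMode hB hc k (n - 1 + m))

theorem modeL_mul_oddMode (hB : B.IsSymm) (hc : IsInvGram B b c) (k : Fin r) (m n : ℤ) :
    modeL B b c n * oddMode B b (toW (b k)) m =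
      oddMode B b (toW (b k)) m * modeL B b c n +
        (-((n : ℂ) + 2 * m)) • oddMode B b (toW (b k)) (n - 1 + m) := by
  have h := opS_mul_evenMode hB hc k (n + m)
  rw [show n + m - 1 = n - 1 + m by ring] at h
  rw [modeL_eq hB hc]
  exact anticommutator_mul_odd (R := Module.End ℂ (Fock r Q)) (oddMode_mul_modeG hB hc k m n)
    (opS_mul_oddMode hB hc k m) (evenMode_mul_modeG hB hc k m n) h (by push_cast; ring)

end Superconformal

/-! ### The fields of the states `S h`, `G` and `S G` -/

section StateField

open scoped VertexOperator

theorem dividedDeriv_zero {r : ℕ} {Q : Type*} (A : VertexOperator ℂ (Fock r Q)) :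
    dividedDeriv 0 A = A := by
  rw [dividedDeriv, Nat.factorial_zero, Nat.cast_one, inv_one]
  exact one_smul ℂ A

theorem dividedDeriv_one {r : ℕ} {Q : Type*} (A : VertexOperator ℂ (Fock r Q)) :
    dividedDeriv 1 A = fieldDeriv A := by
  rw [dividedDeriv, Nat.factorial_one, Nat.cast_one, inv_one]
  exact one_smul ℂ (fieldDeriv A)

variable {r : ℕ} {Q : Type*} [AddCommGroup Q]
  (B : LinearMap.BilinForm ℤ Q) (b : Module.Basis (Fin r) ℤ Q) (ε : Q → Q → ℂˣ)

theorem toW_zero : toW (0 : Q) = 0 := TensorProduct.tmul_zero Q (1 : ℂ)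

theorem evenMode_of_zero (n : ℤ) :
    (evenMode B b 0 n : Module.End ℂ (Fock r Q)) = 0 := by
  rw [evenMode_eq_sum]
  simp [coordW]

theorem oddMode_of_zero (n : ℤ) :
    (oddMode B b 0 n : Module.End ℂ (Fock r Q)) = 0 := by
  rw [oddMode_eq_sum]
  simp [coordW]

theorem expSeries_zero {R : Type*} [Ring R] [Module ℂ R] :
    expSeries (0 : PowerSeries R) = 1 := by
  ext n
  rw [expSeries, PowerSeries.coeff_mk, Finset.sum_range_succ']
  simp

theorem expMinus_zero : (expMinus B b 0 : PowerSeries (Module.End ℂ (Fock r Q))) = 1 := by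
  rw [expMinus]
  refine Eq.trans (congrArg expSeries ?_) expSeries_zero
  ext1 n
  rw [PowerSeries.coeff_mk, toW_zero, evenMode_of_zero, smul_zero, map_zero]

theorem expPlus_zero : (expPlus B b 0 : PowerSeries (Module.End ℂ (Fock r Q))) = 1 := by
  rw [expPlus]
  refine Eq.trans (congrArg expSeries ?_) expSeries_zero
  ext1 n
  rw [PowerSeries.coeff_mk, toW_zero, evenMode_of_zero, smul_zero, map_zero]

variable {ε}

/-- This makes `e^0` act as the scalar `ε 0 0` on every charge, which the factor `(ε 0 0)⁻¹` in the
vacuum then cancels. -/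
theorem cocycle_zero_left (hε : ∀ α β γ : Q, ε α β * ε (α + β) γ = ε β γ * ε α (β + γ)) (β : Q) :
    ε 0 β = ε 0 0 := by
  have := hε 0 0 β
  rw [zero_add, zero_add] at this
  exact (mul_right_cancel this).symm

theorem gammaField_zero (hε : ∀ β, ε 0 β = ε 0 0) :
    gammaField B b ε 0 = constField (Fock r Q) (-1) (ε 0 0) := by
  refine vertexOperator_ext_ncoeff fun n => ?_
  rw [gammaField, ofModes_ncoeff, constField_ncoeff]
  refine end_ext_single fun s => ?_
  rw [gammaMode, onBasis_single, finsum_eq_single _ 0 fun q hq => by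
    rw [expPlus_zero, PowerSeries.coeff_one, if_neg hq, LinearMap.zero_apply, map_zero, map_zero],
    expPlus_zero, PowerSeries.coeff_zero_one, Module.End.one_apply, expMinusCoeff, expMinus_zero,
    PowerSeries.coeff_one]
  simp only [Nat.cast_zero, zero_sub, map_zero, LinearMap.zero_apply, sub_zero]
  by_cases hn : n = -1
  · subst hn
    simp [expMul, onBasis_single_smul, hε s.2.2]
  · rw [if_neg hn]
    split_ifs with h1 h2
    · omega
    · simp
    · simp

theorem nop_constField_right {V : Type*} [AddCommGroup V] [Module ℂ V] (A : VertexOperator ℂ V)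
    (c : ℂ) : nop 1 A (constField _ (-1) c) = c • A := by
  refine vertexOperator_ext_ncoeff fun n => ?_
  rw [nop_ncoeff, nopMode_constField_right, map_smul, Pi.smul_apply]
  simp

theorem oddSign_singleton_self (k : ModeIdx r) : oddSign {k} k = 1 := by
  simp [oddSign, Finset.filter_singleton]

theorem vQ_Y_single (s : FockIdx r Q) (c : ℂ) :
    (vQ B b ε).Y (Finsupp.single s c) =
      c • evenPart B b (oddPart B b ε s.2.2 (s.2.1.sort (· ≤ ·)))
        ((Finsupp.toMultiset s.1).sort (· ≤ ·)) := by
  simp [vQ]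

theorem stateW_basis (l : Fin r) :
    stateW B b ε (toW (b l)) =
      Finsupp.single (0, {toLex (0, l)}, 0) (((ε 0 0)⁻¹ : ℂˣ) : ℂ) := by
  rw [stateW, show (-1 : ℤ) = -((0 : ℕ) : ℤ) - 1 by simp, oddMode_basis_neg, vacuum,
    oddCreate_single]
  simp [oddSign]

theorem stateW_eq_sum (h : ℂ ⊗[ℤ] Q) :
    stateW B b ε h = ∑ l, coordW b h l • stateW B b ε (toW (b l)) := by
  rw [stateW, oddMode_eq_sum]
  simp [stateW]

theorem opS_single (s : FockIdx r Q) (c : ℂ) :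
    opS B b (Finsupp.single s c) = c •
      ((∑ k ∈ s.1.support, (((ofLex k).1 : ℂ) + 1) •
      oddCreate (toLex ((ofLex k).1 + 1, (ofLex k).2)) (evenDeriv k (Finsupp.single s 1))) +
    (∑ k ∈ s.2.1, evenCreate k (oddDeriv k (Finsupp.single s 1))) +
    oddMode B b (toW s.2.2) (-1) (Finsupp.single s 1)) := onBasis_single_smul _ s c

theorem opS_stateW_basis (l : Fin r) :
    opS B b (stateW B b ε (toW (b l))) =
      Finsupp.single (Finsupp.single (toLex (0, l)) 1, ∅, 0) (((ε 0 0)⁻¹ : ℂˣ) : ℂ) := by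
  rw [stateW_basis, opS_single]
  simp only [toW_zero, oddMode_of_zero]
  simp [oddDeriv_single, evenCreate_single, oddSign_singleton_self]

theorem vQ_Y_opS_stateW_basis (hε : ∀ β, ε 0 β = ε 0 0) (l : Fin r) :
    (vQ B b ε).Y (opS B b (stateW B b ε (toW (b l)))) = evenField B b (toW (b l)) := by
  rw [opS_stateW_basis, vQ_Y_single]
  simp [evenPart, oddPart, gammaField_zero B b hε, dividedDeriv_zero, nop_constField_right]
  exact inv_smul_smul₀ (ε 0 0).ne_zero (evenField B b (toW (b l)))

variable {κ : Type*} [Fintype κ]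

/-- The coordinates of `∑ᵢ aᵢ ⊗ a'ᵢ`. -/
def casimirCoord (b : Module.Basis (Fin r) ℤ Q) (a a' : κ → ℂ ⊗[ℤ] Q) (l m : Fin r) : ℂ :=
  ∑ i, coordW b (a i) l * coordW b (a' i) m

theorem vecG_eq_sum (hε : ∀ β, ε 0 β = ε 0 0) (a a' : κ → ℂ ⊗[ℤ] Q) :
    vecG B b ε a a' = ∑ l, ∑ m, casimirCoord b a a' l m •
      Finsupp.single (Finsupp.single (toLex (0, l)) 1, {toLex (0, m)}, 0)
        (((ε 0 0)⁻¹ : ℂˣ) : ℂ) := by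
  have key : ∀ l m, (((vQ B b ε).Y ((opS B b) (stateW B b ε (toW (b l)))))[[-1]])
      (stateW B b ε (toW (b m))) =
      Finsupp.single (Finsupp.single (toLex (0, l)) 1, {toLex (0, m)}, 0)
        (((ε 0 0)⁻¹ : ℂˣ) : ℂ) := fun l m => by
    rw [vQ_Y_opS_stateW_basis B b hε, evenField_ncoeff,
      show (-1 : ℤ) = -((0 : ℕ) : ℤ) - 1 by simp, evenMode_basis_neg, stateW_basis,
      evenCreate_single]
    simp
  have hi : ∀ i, (vQ B b ε).normalProd ((vQ B b ε).S (stateW B b ε (a i)))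
      (stateW B b ε (a' i)) = ∑ l, ∑ m, (coordW b (a i) l * coordW b (a' i) m) •
      Finsupp.single (Finsupp.single (toLex (0, l)) 1, {toLex (0, m)}, 0)
        (((ε 0 0)⁻¹ : ℂˣ) : ℂ) := fun i => by
    change (((vQ B b ε).Y (opS B b (stateW B b ε (a i))))[[-1]]) (stateW B b ε (a' i)) = _
    rw [stateW_eq_sum B b (a i), stateW_eq_sum B b (a' i)]
    simp only [map_sum, map_smul, Finset.sum_apply, Pi.smul_apply, LinearMap.sum_apply,
      LinearMap.smul_apply, key,
      Finset.smul_sum, smul_smul]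
    rw [Finset.sum_comm]
    refine Finset.sum_congr rfl fun l _ => Finset.sum_congr rfl fun m _ => ?_
    rw [mul_comm]
  rw [vecG, Finset.sum_congr rfl fun i _ => hi i, Finset.sum_comm]
  refine Finset.sum_congr rfl fun l _ => ?_
  rw [Finset.sum_comm]
  refine Finset.sum_congr rfl fun m _ => ?_
  rw [casimirCoord, Finset.sum_smul]

theorem vQ_Y_vecG_ncoeff (hε : ∀ β, ε 0 β = ε 0 0) (a a' : κ → ℂ ⊗[ℤ] Q) (n : ℤ) :
    ((vQ B b ε).Y (vecG B b ε a a'))[[n]] = modeG B b (casimirCoord b a a') n := by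
  rw [vecG_eq_sum B b hε, modeG]
  simp only [map_sum, map_smul, Finset.sum_apply, Pi.smul_apply]
  refine Finset.sum_congr rfl fun l _ => Finset.sum_congr rfl fun m _ => ?_
  congr 1
  rw [vQ_Y_single]
  simp [evenPart, oddPart, gammaField_zero B b hε, dividedDeriv_zero, nop_constField_right,
    nop_ncoeff, nopMode_smul_right]

theorem opS_vecG (hε : ∀ β, ε 0 β = ε 0 0) (a a' : κ → ℂ ⊗[ℤ] Q) :
    opS B b (vecG B b ε a a') = ∑ l, ∑ m, casimirCoord b a a' l m •
      (Finsupp.single (0, {toLex (0, m), toLex (1, l)}, 0) (-(((ε 0 0)⁻¹ : ℂˣ) : ℂ)) +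
      Finsupp.single (Finsupp.single (toLex (0, m)) 1 + Finsupp.single (toLex (0, l)) 1, ∅, 0)
        (((ε 0 0)⁻¹ : ℂˣ) : ℂ)) := by
  rw [vecG_eq_sum B b hε]
  simp only [map_sum, map_smul]
  refine Finset.sum_congr rfl fun l _ => Finset.sum_congr rfl fun m _ => ?_
  congr 1
  have hlt : toLex ((0 : ℕ), m) < toLex (1, l) := Prod.Lex.toLex_lt_toLex.2 (Or.inl zero_lt_one)
  rw [opS_single]
  simp only [toW_zero, oddMode_of_zero]
  -- The generator of label `(1, l)` created from `b_l` stands to the right of `(0, m)` in the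
  -- ordered product; moving it there costs a sign.
  have h1 : oddSign {toLex ((0 : ℕ), m)} (toLex (1, l)) = -1 := by
    rw [oddSign, Finset.filter_singleton, if_pos hlt]
    simp
  simp [oddDeriv_single, evenCreate_single, oddCreate_single, evenDeriv_single, h1,
    oddSign_singleton_self, -Finsupp.single_mul]
  rw [Finset.pair_comm, add_comm (Finsupp.single (toLex (0, l)) 1)]

theorem vQ_Y_opS_vecG_ncoeff (hε : ∀ β, ε 0 β = ε 0 0) (hB : B.IsSymm) (a a' : κ → ℂ ⊗[ℤ] Q) (n : ℤ) :
    ((vQ B b ε).Y (opS B b (vecG B b ε a a')))[[n]] = modeL B b (casimirCoord b a a') n := by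
  rw [opS_vecG B b hε, modeL]
  simp only [map_sum, map_smul, Finset.sum_apply, Pi.smul_apply]
  refine Finset.sum_congr rfl fun l _ => Finset.sum_congr rfl fun m _ => ?_
  congr 1
  have hlt : toLex ((0 : ℕ), m) < toLex (1, l) := Prod.Lex.toLex_lt_toLex.2 (Or.inl zero_lt_one)
  rw [map_add, map_add, Pi.add_apply, vQ_Y_single, vQ_Y_single, add_comm]
  congr 1
  · rw [map_add, Finsupp.toMultiset_single, Finsupp.toMultiset_single, one_smul, one_smul]
    -- The field of a basis vector uses the sorted list of its even labels, so the two currents may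
    -- appear in either order.
    rcases le_total (toLex ((0 : ℕ), m)) (toLex (0, l)) with h | h
    · rw [Multiset.singleton_add, Multiset.sort_cons _ _ _ (by simpa using h)]
      simp [evenPart, oddPart, gammaField_zero B b hε, dividedDeriv_zero,
        nop_constField_right, nop_ncoeff, nopMode_smul_right]
      exact nopMode_evenField_swap hB m l n
    · rw [add_comm {toLex ((0 : ℕ), m)}, Multiset.singleton_add, Multiset.sort_cons _ _ _ (by simpa using h)]
      simp [evenPart, oddPart, gammaField_zero B b hε, dividedDeriv_zero,
        nop_constField_right, nop_ncoeff, nopMode_smul_right]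
  · rw [Finset.sort_insert (· ≤ ·) (by simpa using hlt.le) (by simp)]
    simp [evenPart, oddPart, gammaField_zero B b hε, dividedDeriv_zero, dividedDeriv_one,
      nop_constField_right, nop_ncoeff, nopMode_smul_right]
    rw [smul_smul, neg_mul, inv_mul_cancel₀ (Units.ne_zero _)]

end StateField

/-! ### The inverse Gram matrix, ground states and the spectrum of `G_(1|0)` -/

section Spectrum

theorem evenDegree_add_single {r : ℕ} {Q : Type*}
    (ν : ModeIdx r →₀ ℕ) (F : Finset (ModeIdx r)) (β : Q)
    (k : ModeIdx r) : evenDegree ((ν + Finsupp.single k 1, F, β) : FockIdx r Q) =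
      evenDegree ((ν, F, β) : FockIdx r Q) + ((ofLex k).1 + 1) := by
  simp only [evenDegree]
  rw [Finsupp.sum_add_index' (by simp) (by intros; push_cast; ring),
    Finsupp.sum_single_index (by simp)]
  simp

theorem le_evenDegree {r : ℕ} {Q : Type*} (s : FockIdx r Q)
    (k : ModeIdx r) :
    (s.1 k : ℤ) * ((ofLex k).1 + 1) ≤ evenDegree s := by
  by_cases hk : k ∈ s.1.support
  · exact Finset.single_le_sum (f := fun k => (s.1 k : ℤ) * ((ofLex k).1 + 1))
      (fun _ _ => by positivity) hk
  · rw [Finsupp.notMem_support_iff.1 hk]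
    simpa using evenDegree_nonneg s

variable {r : ℕ} {Q : Type*} [AddCommGroup Q]
  {B : LinearMap.BilinForm ℤ Q} {b : Module.Basis (Fin r) ℤ Q} {c : Fin r → Fin r → ℂ}

/-- Duality gives the expansion `x = ∑ (a_i, x) a'_i`; for `x` in the basis `b` this says Gram
matrix times Casimir matrix is `1`. Since the Gram matrix is symmetric, the transposed Casimir
matrix is a left inverse, hence equals the right inverse. -/
theorem isInvGram_casimirCoord {κ : Type*} [Fintype κ] [DecidableEq κ] (hB : B.IsSymm)
    (a a' : Module.Basis κ ℂ (ℂ ⊗[ℤ] Q))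
    (hdual : ∀ i j, formW B (a i) (a' j) = if i = j then 1 else 0) :
    IsInvGram B b (casimirCoord b a a') := by
  have hg : ∀ k m, ∑ l, gramW B b k l * casimirCoord b a a' l m = if k = m then 1 else 0 := by
    intro k m
    have h1 : ∑ i, formW B (a i) (toW (b k)) • a' i = toW (b k) := by
      conv_rhs => rw [← a'.sum_repr (toW (b k))]
      refine Finset.sum_congr rfl fun i _ => ?_
      congr 1
      rw [← congrArg (formW B (a i)) (a'.sum_repr (toW (b k)))]
      simp only [map_sum, map_smul, hdual, smul_eq_mul]
      simp
    rw [← coordW_toW_basis b k m, ← h1]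
    have h2 : coordW b (∑ i, formW B (a i) (toW (b k)) • a' i) m =
        ∑ i, formW B (a i) (toW (b k)) * coordW b (a' i) m := by
      simp [coordW]
    rw [h2]
    simp only [formW_eq_sum_left B b (a _), casimirCoord, Finset.mul_sum, Finset.sum_mul]
    rw [Finset.sum_comm]
    refine Finset.sum_congr rfl fun i _ => Finset.sum_congr rfl fun l _ => ?_
    rw [gramW_symm B b hB, gramW]
    ring
  refine ⟨fun l m => ?_, hg⟩
  let M : Matrix (Fin r) (Fin r) ℂ := Matrix.of (gramW B b)
  let C : Matrix (Fin r) (Fin r) ℂ := Matrix.of (casimirCoord b a a')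
  have hMC : M * C = 1 := by
    ext k m
    rw [Matrix.mul_apply, Matrix.one_apply]
    exact hg k m
  have hM : M.transpose = M := by
    ext k m
    exact gramW_symm B b hB m k
  have hCM : C.transpose * M = 1 := by
    rw [← hM, ← Matrix.transpose_mul, hMC, Matrix.transpose_one]
  have hC : C = C.transpose := by
    rw [← mul_one C.transpose, ← hMC, ← mul_assoc, hCM, one_mul]
  exact congrFun (congrFun hC l) m

theorem evenMode_pos_ground (h : ℂ ⊗[ℤ] Q) {n : ℤ} (hn : 0 < n) (β : Q) (x : ℂ) :
    evenMode B b h n (Finsupp.single (0, ∅, β) x) = 0 := by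
  obtain ⟨m, rfl⟩ : ∃ m : ℕ, n = (m : ℤ) + 1 := ⟨(n - 1).toNat, by omega⟩
  simp [evenMode_succ, evenDeriv_single]

theorem oddMode_nonneg_ground (h : ℂ ⊗[ℤ] Q) {n : ℤ} (hn : 0 ≤ n) (β : Q) (x : ℂ) :
    oddMode B b h n (Finsupp.single (0, ∅, β) x) = 0 := by
  obtain ⟨m, rfl⟩ : ∃ m : ℕ, n = (m : ℤ) := ⟨n.toNat, by omega⟩
  simp [oddMode_natCast, oddDeriv_single]

/-- Every term has an annihilator acting first, except the one beginning with the even zero mode;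
that mode is a scalar and is followed by an odd mode of index `n - 1 ≥ 0`. -/
theorem modeG_pos_ground {n : ℤ} (hn : 0 < n) (β : Q) (x : ℂ) :
    modeG B b c n (Finsupp.single (0, ∅, β) x) = 0 := by
  simp only [modeG, LinearMap.sum_apply, LinearMap.smul_apply, nopMode_apply, evenField_ncoeff,
    oddField_ncoeff]
  refine Finset.sum_eq_zero fun l _ => Finset.sum_eq_zero fun m _ => ?_
  rw [finsum_eq_zero_of_forall_eq_zero fun j => ?_, finsum_eq_zero_of_forall_eq_zero fun j => ?_]
  · simp
  · rcases Nat.eq_zero_or_pos j with rfl | hj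
    · rw [Nat.cast_zero, evenMode_zero_single, map_smul, oddMode_nonneg_ground _ (by omega),
        smul_zero]
    · rw [evenMode_pos_ground _ (by omega), map_zero]
  · rw [oddMode_nonneg_ground _ (by omega), map_zero]

theorem modeG_evenMode_apply (hB : B.IsSymm) (hc : IsInvGram B b c) (k : Fin r) (m n : ℤ)
    (v : Fock r Q) : modeG B b c n (evenMode B b (toW (b k)) m v) =
      evenMode B b (toW (b k)) m (modeG B b c n v) -
        (m : ℂ) • oddMode B b (toW (b k)) (n - 1 + m) v := by
  rw [eq_sub_iff_add_eq]
  exact (LinearMap.congr_fun (evenMode_mul_modeG hB hc k m n) v).symm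

theorem modeG_oddMode_apply (hB : B.IsSymm) (hc : IsInvGram B b c) (h : ℂ ⊗[ℤ] Q) (m n : ℤ)
    (v : Fock r Q) : modeG B b c n (oddMode B b h m v) =
      evenMode B b h (n + m) v - oddMode B b h m (modeG B b c n v) := by
  rw [oddMode_eq_sum B b h, evenMode_eq_sum B b h]
  simp only [LinearMap.sum_apply, LinearMap.smul_apply, map_sum, map_smul,
    ← Finset.sum_sub_distrib, ← smul_sub]
  refine Finset.sum_congr rfl fun l _ => ?_
  congr 1
  have := LinearMap.congr_fun (oddMode_mul_modeG hB hc l m n) v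
  simp only [Module.End.mul_apply, LinearMap.add_apply, LinearMap.smul_apply] at this
  rw [this]
  module

theorem modeL_oddMode_apply (hB : B.IsSymm) (hc : IsInvGram B b c) (h : ℂ ⊗[ℤ] Q) (m n : ℤ)
    (v : Fock r Q) : modeL B b c n (oddMode B b h m v) =
      oddMode B b h m (modeL B b c n v) + (-((n : ℂ) + 2 * m)) • oddMode B b h (n - 1 + m) v := by
  rw [oddMode_eq_sum B b h, oddMode_eq_sum B b h (n - 1 + m)]
  simp only [LinearMap.sum_apply, LinearMap.smul_apply, map_sum, map_smul,
    Finset.smul_sum, ← Finset.sum_add_distrib]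
  refine Finset.sum_congr rfl fun l _ => ?_
  have := LinearMap.congr_fun (modeL_mul_oddMode hB hc l m n) v
  simp only [Module.End.mul_apply, LinearMap.add_apply, LinearMap.smul_apply] at this
  rw [this]
  module

theorem modeL_evenMode_apply (hB : B.IsSymm) (hc : IsInvGram B b c) (k : Fin r) (m n : ℤ)
    (v : Fock r Q) : modeL B b c n (evenMode B b (toW (b k)) m v) =
      evenMode B b (toW (b k)) m (modeL B b c n v) +
        (-(2 * (m : ℂ))) • evenMode B b (toW (b k)) (n - 1 + m) v :=
  LinearMap.congr_fun (modeL_mul_evenMode hB hc k m n) v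

theorem opS_ground (β : Q) (x : ℂ) :
    opS B b (Finsupp.single (0, ∅, β) x) =
      oddMode B b (toW β) (-1) (Finsupp.single (0, ∅, β) x) := by
  rw [opS_single]
  simp [← map_smul]

/-- In `{S, G_(n|1)}` only `G_(n|1) S` survives; `S` creates `β_(-1|1)`, and anticommuting `G_(n|1)`
past it leaves `β_(n-1|0)`. -/
theorem modeL_ground (hB : B.IsSymm) (hc : IsInvGram B b c) {n : ℤ} (hn : 0 < n) (β : Q) (x : ℂ) :
    modeL B b c n (Finsupp.single (0, ∅, β) x) =
      evenMode B b (toW β) (n - 1) (Finsupp.single (0, ∅, β) x) := by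
  rw [modeL_eq hB hc, LinearMap.add_apply, Module.End.mul_apply, Module.End.mul_apply,
    modeG_pos_ground hn, opS_ground, modeG_oddMode_apply hB hc, modeG_pos_ground hn, map_zero,
    map_zero, zero_add, sub_zero, ← sub_eq_add_neg]

/-- Twice the conformal weight of a basis vector. -/
def fockWeight (B : LinearMap.BilinForm ℤ Q) (s : FockIdx r Q) : ℤ :=
  2 * evenDegree s + ∑ k ∈ s.2.1, (2 * ((ofLex k).1 : ℤ) + 1) + B s.2.2 s.2.2

/-- The ground state of charge `β` has eigenvalue `(β, β)`. The generators `h_(-m-1|0)` and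
`h_(-m-1|1)` raise the eigenvalue by `2(m + 1)` and `2m + 1`, by their commutators with `G_(1|0)`.
-/
theorem modeL_one_single (hB : B.IsSymm) (hc : IsInvGram B b c) (s : FockIdx r Q) (x : ℂ) :
    modeL B b c 1 (Finsupp.single s x) = (fockWeight B s : ℂ) • Finsupp.single s x := by
  obtain ⟨ν, F, β⟩ := s
  have base : modeL B b c 1 (Finsupp.single (0, F, β) x) =
      (fockWeight B ((0, F, β) : FockIdx r Q) : ℂ) • Finsupp.single (0, F, β) x := by
    induction F using Finset.induction_on with
    | empty =>
      rw [modeL_ground hB hc one_pos, sub_self, evenMode_zero_single, formW_toW]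
      simp [fockWeight, evenDegree]
    | insert k F hk ih =>
      -- The new generator need not come first in the order, hence the sign; being its own inverse,
      -- it can stand on this side.
      have hs : Finsupp.single (0, insert k F, β) x = oddSign F k •
          oddMode B b (toW (b (ofLex k).2)) (-((ofLex k).1 : ℤ) - 1)
            (Finsupp.single (0, F, β) x) := by
        rw [oddMode_basis_neg, show toLex ((ofLex k).1, (ofLex k).2) = k from rfl, oddCreate_single,
          if_neg hk, Finsupp.smul_single, smul_eq_mul,
          mul_left_comm, oddSign_mul_self, mul_one]
      rw [hs, map_smul, modeL_oddMode_apply hB hc, ih, map_smul, sub_self, zero_add, ← add_smul,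
        smul_comm]
      congr 1
      simp only [fockWeight, Finset.sum_insert hk, evenDegree]
      push_cast
      ring
  have step : ∀ (ν : ModeIdx r →₀ ℕ) (k : ModeIdx r),
      modeL B b c 1 (Finsupp.single (ν, F, β) x) =
        (fockWeight B ((ν, F, β) : FockIdx r Q) : ℂ) • Finsupp.single (ν, F, β) x →
      modeL B b c 1 (Finsupp.single (ν + Finsupp.single k 1, F, β) x) =
        (fockWeight B ((ν + Finsupp.single k 1, F, β) : FockIdx r Q) : ℂ) •
          Finsupp.single (ν + Finsupp.single k 1, F, β) x := by
    intro ν k h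
    have hs : Finsupp.single (ν + Finsupp.single k 1, F, β) x =
        evenMode B b (toW (b (ofLex k).2)) (-((ofLex k).1 : ℤ) - 1)
          (Finsupp.single (ν, F, β) x) := by
      rw [evenMode_basis_neg]
      exact (evenCreate_single k (ν, F, β) x).symm
    rw [hs, modeL_evenMode_apply hB hc, h, map_smul, sub_self, zero_add, ← add_smul]
    congr 1
    simp only [fockWeight, evenDegree_add_single]
    push_cast
    ring
  induction ν using Finsupp.induction with
  | zero => exact base
  | single_add k n f _ _ ih =>
    rw [add_comm]
    have : ∀ n : ℕ, modeL B b c 1 (Finsupp.single (f + Finsupp.single k n, F, β) x) =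
        (fockWeight B ((f + Finsupp.single k n, F, β) : FockIdx r Q) : ℂ) •
          Finsupp.single (f + Finsupp.single k n, F, β) x := by
      intro n
      induction n with
      | zero => simpa using ih
      | succ n ihn =>
        rw [Finsupp.single_add, ← add_assoc]
        exact step _ k ihn
    exact this n

theorem modeL_one_apply (hB : B.IsSymm) (hc : IsInvGram B b c) (v : Fock r Q) (s : FockIdx r Q) :
    modeL B b c 1 v s = (fockWeight B s : ℂ) * v s := by
  induction v using Finsupp.induction_linear with
  | zero => simp
  | add v w hv hw => rw [map_add, Finsupp.add_apply, hv, hw, Finsupp.add_apply, mul_add]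
  | single t x =>
    rw [modeL_one_single hB hc, Finsupp.smul_apply, smul_eq_mul]
    by_cases h : t = s
    · rw [h]
    · simp [h]

theorem iSup_eigenspace_modeL_one (hB : B.IsSymm) (hc : IsInvGram B b c) :
    ⨆ μ : ℂ, Module.End.eigenspace (modeL B b c 1) μ = ⊤ := by
  refine eq_top_iff.2 fun v _ => ?_
  induction v using Finsupp.induction_linear with
  | zero => exact Submodule.zero_mem _
  | add v w hv hw => exact Submodule.add_mem _ (hv trivial) (hw trivial)
  | single s x =>
    exact Submodule.mem_iSup_of_mem (fockWeight B s : ℂ)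
      (Module.End.mem_eigenspace_iff.2 (modeL_one_single hB hc s x))

theorem eigenspace_modeL_one_le (hB : B.IsSymm) (hc : IsInvGram B b c) (μ : ℂ) :
    Module.End.eigenspace (modeL B b c 1) μ ≤
      Finsupp.supported ℂ ℂ {s : FockIdx r Q | (fockWeight B s : ℂ) = μ} := by
  intro v hv s hs
  have h := DFunLike.congr_fun (Module.End.mem_eigenspace_iff.1 hv) s
  rw [modeL_one_apply hB hc, Finsupp.smul_apply, smul_eq_mul] at h
  exact mul_right_cancel₀ (Finsupp.mem_support_iff.1 hs) h

/-- By Cauchy–Schwarz, `(β, β) ≤ N` bounds the integers `(β, b_i)`, and by positive definiteness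
these integers determine `β`. -/
theorem finite_setOf_form_le (hB : B.IsSymm) (b : Module.Basis (Fin r) ℤ Q)
    (hpos : ∀ α : Q, α ≠ 0 → 0 < B α α) (N : ℤ) : {β : Q | B β β ≤ N}.Finite := by
  have hnonneg : ∀ α, 0 ≤ B α α := fun α => by
    by_cases h : α = 0
    · simp [h]
    · exact (hpos α h).le
  have hinj : Function.Injective fun (β : Q) (i : Fin r) => B β (b i) := by
    intro β γ h
    by_contra hne
    have h0 : B (β - γ) = 0 := b.ext fun i => by
      simpa [sub_eq_zero] using congrFun h i
    have := hpos (β - γ) (sub_ne_zero.2 hne)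
    rw [h0] at this
    simp at this
  refine Set.Finite.of_finite_image (f := fun (β : Q) (i : Fin r) => B β (b i)) ?_ hinj.injOn
  refine (Set.finite_Icc (fun i => -(N * B (b i) (b i))) fun i => N * B (b i) (b i)).subset ?_
  rintro _ ⟨β, hβ, rfl⟩
  have key : ∀ i, |B β (b i)| ≤ N * B (b i) (b i) := fun i => by
    have h1 := LinearMap.BilinForm.apply_sq_le_of_symm B hnonneg ⟨hB.eq⟩ β (b i)
    have h2 : B β β * B (b i) (b i) ≤ N * B (b i) (b i) :=
      mul_le_mul_of_nonneg_right hβ (hnonneg _)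
    -- For an integer, `|x| ≤ x²`, so the bound on the square serves without a square root.
    have h3 : |B β (b i)| ≤ B β (b i) ^ 2 := by
      rw [← sq_abs]
      exact Int.le_self_sq _
    omega
  exact ⟨fun i => (abs_le.1 (key i)).1, fun i => (abs_le.1 (key i)).2⟩

/-- All three contributions to the weight are nonnegative, and each occurrence of a generator costs
at least `1` and at least its mode label. A bound `N` thus limits mode labels, exponents and `(β,
β)` to at most `N`. -/
theorem finite_setOf_fockWeight_le (hB : B.IsSymm) (b : Module.Basis (Fin r) ℤ Q)
    (hpos : ∀ α : Q, α ≠ 0 → 0 < B α α) (N : ℕ) :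
    {s : FockIdx r Q | fockWeight B s ≤ N}.Finite := by
  have hnonneg : ∀ α, 0 ≤ B α α := fun α => by
    by_cases h : α = 0
    · simp [h]
    · exact (hpos α h).le
  let K : Finset (ModeIdx r) :=
    (Finset.range (N + 1) ×ˢ Finset.univ).map (toLex (α := ℕ × Fin r)).toEmbedding
  have hK : ∀ k : ModeIdx r, (ofLex k).1 ≤ N → k ∈ K := fun k hk => by
    rw [Finset.mem_map]
    exact ⟨ofLex k, by simpa using Nat.lt_succ_of_le hk, rfl⟩
  refine ((Set.finite_Iic (∑ k ∈ K, Finsupp.single k N)).prod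
    ((Finset.finite_toSet K.powerset).prod (finite_setOf_form_le hB b hpos N))).subset ?_
  intro s hs
  have h1 : 0 ≤ ∑ k ∈ s.2.1, (2 * ((ofLex k).1 : ℤ) + 1) :=
    Finset.sum_nonneg fun _ _ => by positivity
  have h2 := evenDegree_nonneg s
  have h3 := hnonneg s.2.2
  simp only [Set.mem_ofPred_eq, fockWeight] at hs
  refine ⟨fun k => ?_, ?_, ?_⟩
  · have h4 := le_evenDegree s k
    rw [Finsupp.finsetSum_apply]
    by_cases hk : s.1 k = 0
    · rw [hk]
      exact Nat.zero_le _
    have h5 : (1 : ℤ) ≤ s.1 k := by omega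
    have h6 : ((ofLex k).1 : ℤ) + 1 ≤ s.1 k * ((ofLex k).1 + 1) :=
      le_mul_of_one_le_left (by positivity) h5
    have h7 : (s.1 k : ℤ) ≤ s.1 k * ((ofLex k).1 + 1) :=
      le_mul_of_one_le_right (by positivity) (by omega)
    rw [Finset.sum_eq_single_of_mem k (hK k (by omega)) fun l _ hl => by simp [hl]]
    simp only [Finsupp.single_eq_same]
    omega
  · rw [Finset.mem_coe, Finset.mem_powerset]
    intro k hk
    have := Finset.single_le_sum (f := fun k : ModeIdx r => 2 * ((ofLex k).1 : ℤ) + 1)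
      (fun _ _ => by positivity) hk
    exact hK k (by omega)
  · simp only [Set.mem_ofPred_eq]
    omega

theorem fockWeight_nonneg (hpos : ∀ α : Q, α ≠ 0 → 0 < B α α) (s : FockIdx r Q) :
    0 ≤ fockWeight B s := by
  have h1 : 0 ≤ ∑ k ∈ s.2.1, (2 * ((ofLex k).1 : ℤ) + 1) :=
    Finset.sum_nonneg fun _ _ => by positivity
  have h2 := evenDegree_nonneg s
  have h3 : 0 ≤ B s.2.2 s.2.2 := by
    by_cases h : s.2.2 = 0
    · simp [h]
    · exact (hpos _ h).le
  rw [fockWeight]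
  omega

theorem finiteDimensional_eigenspace_modeL_one (hB : B.IsSymm) (hc : IsInvGram B b c)
    (hpos : ∀ α : Q, α ≠ 0 → 0 < B α α) (μ : ℂ) :
    FiniteDimensional ℂ (Module.End.eigenspace (modeL B b c 1) μ) := by
  have hfin : {s : FockIdx r Q | (fockWeight B s : ℂ) = μ}.Finite := by
    by_cases h : ∃ s : FockIdx r Q, (fockWeight B s : ℂ) = μ
    · obtain ⟨s, rfl⟩ := h
      refine (finite_setOf_fockWeight_le hB b hpos (fockWeight B s).toNat).subset fun t ht => ?_
      have ht' : fockWeight B t = fockWeight B s := by exact_mod_cast ht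
      have := fockWeight_nonneg hpos s
      simp only [Set.mem_ofPred_eq]
      omega
    · refine Set.Finite.subset Set.finite_empty fun s hs => h ⟨s, hs⟩
  have := hfin.to_subtype
  have : FiniteDimensional ℂ (Finsupp.supported ℂ ℂ {s : FockIdx r Q | (fockWeight B s : ℂ) = μ}) :=
    Module.Finite.equiv (Finsupp.supportedEquivFinsupp (R := ℂ) (M := ℂ) _).symm
  exact Submodule.finiteDimensional_of_le (eigenspace_modeL_one_le hB hc μ)

theorem hasEigenvalue_modeL_one (hB : B.IsSymm) (hc : IsInvGram B b c) {μ : ℂ}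
    (h : Module.End.HasEigenvalue (modeL B b c 1) μ) :
    ∃ s : FockIdx r Q, (fockWeight B s : ℂ) = μ := by
  obtain ⟨v, hv⟩ := h.exists_hasEigenvector
  obtain ⟨s, hs⟩ := Finsupp.support_nonempty_iff.2 hv.2
  exact ⟨s, eigenspace_modeL_one_le hB hc μ hv.1 hs⟩

end Spectrum

/-! ### The nonnegative modes of `G` on `h`, `1 ⊗ e^α` and `G` -/

section Brackets

/-- The factor `2` in `hw` is the `2!` that the bracket divides out at `λ²`. -/
theorem SUSYStructure.lambdaBracket_eq {V : Type*} [AddCommGroup V] [Module ℂ V]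
    (𝒱 : SUSYStructure V) {τ v x y z w : V}
    (hx : 𝒱.mode τ 0 0 v = x) (hy : 𝒱.mode τ 1 0 v = y)
    (h0 : ∀ n : ℤ, 2 ≤ n → 𝒱.mode τ n 0 v = 0)
    (hz : 𝒱.mode τ 0 1 v = z) (h1 : 𝒱.mode τ 1 1 v = 0) (hw : 𝒱.mode τ 2 1 v = (2 : ℂ) • w)
    (h3 : ∀ n : ℤ, 3 ≤ n → 𝒱.mode τ n 1 v = 0) :
    𝒱.lambdaBracket τ v = mon 0 0 x + mon 1 0 y + mon 0 1 z + mon 2 1 w := by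
  ext ⟨j, J⟩
  simp only [mon, Finsupp.add_apply, Finsupp.single_apply, Prod.mk.injEq]
  change ((j.factorial : ℂ)⁻¹) • 𝒱.mode τ j J v = _
  match j, J with
  | 0, 0 => simp [hx]
  | 0, 1 => simp [hz]
  | 1, 0 => simp [hy]
  | 1, 1 => simp [h1]
  | 2, 1 => simp [hw]
  | j + 2, 0 => rw [h0 ((j + 2 : ℕ) : ℤ) (by omega)]; simp
  | j + 3, 1 => rw [h3 ((j + 3 : ℕ) : ℤ) (by omega)]; simp

variable {r : ℕ} {Q : Type*} [AddCommGroup Q]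
  {B : LinearMap.BilinForm ℤ Q} {b : Module.Basis (Fin r) ℤ Q} {c : Fin r → Fin r → ℂ}
  {ε : Q → Q → ℂˣ}

theorem evenMode_nonneg_vacuum (h : ℂ ⊗[ℤ] Q) {n : ℤ} (hn : 0 ≤ n) :
    evenMode B b h n (vacuum ε) = 0 := by
  rw [vacuum]
  rcases hn.eq_or_lt with rfl | hn
  · rw [evenMode_zero_single, toW_zero, map_zero, zero_smul]
  · exact evenMode_pos_ground h hn 0 _

theorem modeG_pos_stateW (hB : B.IsSymm) (hc : IsInvGram B b c) (h : ℂ ⊗[ℤ] Q) {n : ℤ}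
    (hn : 0 < n) : modeG B b c n (stateW B b ε h) = 0 := by
  rw [stateW, modeG_oddMode_apply hB hc, evenMode_nonneg_vacuum _ (by omega), vacuum,
    modeG_pos_ground hn, map_zero, sub_zero]

theorem modeL_ge_two_ground (hB : B.IsSymm) (hc : IsInvGram B b c) {n : ℤ} (hn : 2 ≤ n) (β : Q)
    (x : ℂ) : modeL B b c n (Finsupp.single (0, ∅, β) x) = 0 := by
  rw [modeL_ground hB hc (by omega), evenMode_pos_ground _ (by omega)]

theorem modeL_ge_two_stateW (hB : B.IsSymm) (hc : IsInvGram B b c) (h : ℂ ⊗[ℤ] Q) {n : ℤ}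
    (hn : 2 ≤ n) : modeL B b c n (stateW B b ε h) = 0 := by
  rw [stateW, modeL_oddMode_apply hB hc, vacuum, modeL_ge_two_ground hB hc hn, map_zero,
    oddMode_nonneg_ground _ (by omega), smul_zero, add_zero]

theorem modeL_one_stateW (hB : B.IsSymm) (hc : IsInvGram B b c) (h : ℂ ⊗[ℤ] Q) :
    modeL B b c 1 (stateW B b ε h) = stateW B b ε h := by
  rw [stateW_eq_sum, map_sum]
  refine Finset.sum_congr rfl fun l _ => ?_
  rw [map_smul, stateW_basis, modeL_one_single hB hc]
  simp [fockWeight, evenDegree]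

theorem single_eq_evenMode_stateW (l m : Fin r) :
    Finsupp.single (Finsupp.single (toLex (0, l)) 1, {toLex (0, m)}, 0)
        (((ε 0 0)⁻¹ : ℂˣ) : ℂ) =
      evenMode B b (toW (b l)) (-1) (stateW B b ε (toW (b m))) := by
  rw [stateW_basis, show (-1 : ℤ) = -((0 : ℕ) : ℤ) - 1 by simp, evenMode_basis_neg,
    evenCreate_single]
  simp

/-- The vector `∑ c_{lm} (b_l)_(-1|0) (b_m)_(-1|1) |0⟩`. -/
def quadVec (B : LinearMap.BilinForm ℤ Q) (b : Module.Basis (Fin r) ℤ Q) (ε : Q → Q → ℂˣ)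
    (c : Fin r → Fin r → ℂ) : Fock r Q :=
  ∑ l, ∑ m, c l m • evenMode B b (toW (b l)) (-1) (stateW B b ε (toW (b m)))

theorem vecG_eq_quadVec {κ : Type*} [Fintype κ] (hε : ∀ β, ε 0 β = ε 0 0) (a a' : κ → ℂ ⊗[ℤ] Q) :
    vecG B b ε a a' = quadVec B b ε (casimirCoord b a a') := by
  rw [vecG_eq_sum B b hε, quadVec]
  simp only [single_eq_evenMode_stateW (B := B) (b := b)]

theorem modeL_one_quadVec (hB : B.IsSymm) (hc : IsInvGram B b c) :
    modeL B b c 1 (quadVec B b ε c) = (3 : ℂ) • quadVec B b ε c := by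
  simp only [quadVec, ← single_eq_evenMode_stateW, map_sum, map_smul, Finset.smul_sum]
  refine Finset.sum_congr rfl fun l _ => Finset.sum_congr rfl fun m _ => ?_
  rw [modeL_one_single hB hc, smul_comm]
  congr 2
  simp [fockWeight, evenDegree]

theorem evenMode_nonneg_stateW (h h' : ℂ ⊗[ℤ] Q) {n : ℤ} (hn : 0 ≤ n) :
    evenMode B b h n (stateW B b ε h') = 0 := by
  rw [stateW, ← Module.End.mul_apply, (commute_evenMode_oddMode B b h h' n (-1)).eq,
    Module.End.mul_apply, evenMode_nonneg_vacuum h hn, map_zero]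

theorem modeL_ge_two_quadVec (hB : B.IsSymm) (hc : IsInvGram B b c) {n : ℤ} (hn : 2 ≤ n) :
    modeL B b c n (quadVec B b ε c) = 0 := by
  simp only [quadVec, map_sum, map_smul]
  refine Finset.sum_eq_zero fun l _ => Finset.sum_eq_zero fun m _ => ?_
  rw [modeL_evenMode_apply hB hc, modeL_ge_two_stateW hB hc _ hn, map_zero,
    evenMode_nonneg_stateW _ _ (by omega), smul_zero, add_zero, smul_zero]

/-- `G_(n|1)` kills each state `b_m`, so only its commutator with the mode of index `-1` remains. -/
theorem modeG_pos_quadVec (hB : B.IsSymm) (hc : IsInvGram B b c) {n : ℤ} (hn : 0 < n) :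
    modeG B b c n (quadVec B b ε c) =
      ∑ l, ∑ m, c l m • oddMode B b (toW (b l)) (n - 2) (stateW B b ε (toW (b m))) := by
  simp only [quadVec, map_sum, map_smul]
  refine Finset.sum_congr rfl fun l _ => Finset.sum_congr rfl fun m _ => ?_
  rw [modeG_evenMode_apply hB hc, modeG_pos_stateW hB hc _ hn, map_zero,
    show n - 1 + -1 = n - 2 by ring]
  simp

theorem oddMode_stateW_basis (hB : B.IsSymm) (k l : Fin r) (n : ℤ) :
    oddMode B b (toW (b k)) n (stateW B b ε (toW (b l))) =
      -oddMode B b (toW (b l)) (-1) (oddMode B b (toW (b k)) n (vacuum ε)) +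
        (if n = 0 then gramW B b k l else 0) • vacuum ε := by
  have := LinearMap.congr_fun (oddMode_mul_oddMode B b hB k l n (-1)) (vacuum ε)
  simp only [Module.End.mul_apply, LinearMap.add_apply, LinearMap.smul_apply, neg_one_smul,
    Module.End.one_apply] at this
  rw [stateW, this]
  congr 2
  exact if_congr (by omega) rfl rfl

/-- The result contracts the symmetric matrix `c` with a product of two anticommuting creation
operators, so it equals its own negative. -/
theorem modeG_one_quadVec (hB : B.IsSymm) (hc : IsInvGram B b c) :
    modeG B b c 1 (quadVec B b ε c) = 0 := by
  rw [modeG_pos_quadVec hB hc one_pos]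
  refine self_eq_neg.1 ?_
  conv_lhs => rw [Finset.sum_comm]
  rw [← Finset.sum_neg_distrib]
  refine Finset.sum_congr rfl fun l _ => ?_
  rw [← Finset.sum_neg_distrib]
  refine Finset.sum_congr rfl fun m _ => ?_
  rw [oddMode_stateW_basis hB, hc.symm m l]
  simp [stateW]

/-- The central term: the contraction is `∑ c_{lm} (b_l, b_m)`, the trace of the identity matrix of
size `r`. -/
theorem modeG_two_quadVec (hB : B.IsSymm) (hc : IsInvGram B b c) :
    modeG B b c 2 (quadVec B b ε c) = (r : ℂ) • vacuum ε := by
  rw [modeG_pos_quadVec hB hc two_pos]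
  have : ∀ l m, oddMode B b (toW (b l)) (2 - 2) (stateW B b ε (toW (b m))) =
      gramW B b l m • vacuum ε := fun l m => by
    rw [oddMode_stateW_basis hB, vacuum, oddMode_nonneg_ground _ (by norm_num)]
    simp
  simp only [this, smul_smul, ← Finset.sum_smul]
  congr 1
  have h : ∀ l, ∑ m, c l m * gramW B b l m = 1 := fun l => by
    rw [← (hc.mul_gram hB l l).trans (if_pos rfl)]
    exact Finset.sum_congr rfl fun m _ => by rw [gramW_symm B b hB]
  simp [h]

theorem modeG_ge_three_quadVec (hB : B.IsSymm) (hc : IsInvGram B b c) {n : ℤ} (hn : 3 ≤ n) :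
    modeG B b c n (quadVec B b ε c) = 0 := by
  rw [modeG_pos_quadVec hB hc (by omega)]
  refine Finset.sum_eq_zero fun l _ => Finset.sum_eq_zero fun m _ => ?_
  rw [oddMode_stateW_basis hB, vacuum, oddMode_nonneg_ground _ (by omega), if_neg (by omega)]
  simp

end Brackets

end SUSYLattice

end

theorem mainTheorem2 {Q : Type*} [AddCommGroup Q] {r : ℕ} (b : Module.Basis (Fin r) ℤ Q)
    (B : LinearMap.BilinForm ℤ Q) (hsymm : B.IsSymm) (hnondeg : B.Nondegenerate)
    (ε : Q → Q → ℂˣ)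
    (hcocycle : ∀ α β γ : Q, ε α β * ε (α + β) γ = ε β γ * ε α (β + γ))
    (hlocal : ∀ α β : Q, ε α β = (-1 : ℂˣ) ^ (B α β + B α α * B β β) * ε β α)
    {κ : Type*} [Fintype κ] [DecidableEq κ]
    (a a' : Module.Basis κ ℂ (TensorProduct ℤ ℂ Q))
    (hdual : ∀ i j, SUSYLattice.formW B (a i) (a' j) = if i = j then 1 else 0) :
    (SUSYLattice.vQ B b ε).IsConformalVector (SUSYLattice.vecG B b ε a a')
      (3 / 2 * (Module.finrank ℤ Q : ℂ)) ∧
    ((∀ α : Q, α ≠ 0 → 0 < B α α) →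
      (SUSYLattice.vQ B b ε).EnergyBoundedBelow (SUSYLattice.vecG B b ε a a')) ∧
    (∀ h : TensorProduct ℤ ℂ Q,
      (SUSYLattice.vQ B b ε).IsPrimary (SUSYLattice.vecG B b ε a a')
        (SUSYLattice.stateW B b ε h) (1 / 2)) ∧
    (∀ α : Q,
      (SUSYLattice.vQ B b ε).IsPrimary (SUSYLattice.vecG B b ε a a')
        (SUSYLattice.stateExp r α) ((B α α : ℂ) / 2)) := by
  open SUSYLattice in
  have hc : IsInvGram B b (casimirCoord b a a') := isInvGram_casimirCoord hsymm a a' hdual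
  have hε : ∀ β, ε 0 β = ε 0 0 := cocycle_zero_left hcocycle
  have m0 : ∀ n, (vQ B b ε).mode (vecG B b ε a a') n 0 = modeL B b (casimirCoord b a a') n :=
    vQ_Y_opS_vecG_ncoeff B b hε hsymm a a'
  have m1 : ∀ n, (vQ B b ε).mode (vecG B b ε a a') n 1 = modeG B b (casimirCoord b a a') n :=
    vQ_Y_vecG_ncoeff B b hε a a'
  have hT : modeL B b (casimirCoord b a a') 0 = (2 : ℂ) • (vQ B b ε).T := by
    rw [modeL_eq hsymm hc, modeG_zero hsymm hc, two_smul]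
    rfl
  have hS : modeG B b (casimirCoord b a a') 0 = (vQ B b ε).S := modeG_zero hsymm hc
  have hG := vecG_eq_quadVec (B := B) (b := b) hε a a'
  refine ⟨⟨?_, (m0 0).trans hT, (m1 0).trans hS, ?_⟩, fun hpos => ⟨⟨0, fun μ hμ => ?_⟩, fun μ => ?_⟩,
    fun h => ?_, fun α => ?_⟩
  · refine (vQ B b ε).lambdaBracket_eq ?_ ?_ (fun n hn => ?_) ?_ ?_ ?_ fun n hn => ?_
    · rw [m0, hT, LinearMap.smul_apply]
    · rw [m0, hG, modeL_one_quadVec hsymm hc]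
    · rw [m0, hG, modeL_ge_two_quadVec hsymm hc hn]
    · rw [m1, hS]
    · rw [m1, hG, modeG_one_quadVec hsymm hc]
    -- The central charge is read off from `r = 2! · (c / 3)`, that is `c = 3r/2`.
    · rw [m1, hG, modeG_two_quadVec hsymm hc, smul_smul, Module.finrank_eq_card_basis b,
        Fintype.card_fin]
      congr 1
      ring
    · rw [m1, hG, modeG_ge_three_quadVec hsymm hc hn]
  · rw [m0]
    exact iSup_eigenspace_modeL_one hsymm hc
  · rw [m0] at hμ
    obtain ⟨s, rfl⟩ := hasEigenvalue_modeL_one hsymm hc hμ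
    exact ⟨fockWeight B s, by exact_mod_cast fockWeight_nonneg hpos s, by simp⟩
  · rw [m0]
    exact finiteDimensional_eigenspace_modeL_one hsymm hc hpos μ
  -- Being primary means the absence of a `λ²χ` term, hence the zero for `w`.
  · refine ((vQ B b ε).lambdaBracket_eq (w := 0) rfl rfl (fun n hn => ?_) rfl ?_ ?_
      fun n hn => ?_).trans ?_
    · rw [m0, modeL_ge_two_stateW hsymm hc _ hn]
    · rw [m1, modeG_pos_stateW hsymm hc _ one_pos]
    · rw [m1, modeG_pos_stateW hsymm hc _ two_pos, smul_zero]
    · rw [m1, modeG_pos_stateW hsymm hc _ (by omega)]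
    · rw [m0, m0, m1, hT, hS, modeL_one_stateW hsymm hc]
      simp [SUSYStructure.mon]
  · refine ((vQ B b ε).lambdaBracket_eq (w := 0) rfl rfl (fun n hn => ?_) rfl ?_ ?_
      fun n hn => ?_).trans ?_
    · rw [m0, stateExp, modeL_ge_two_ground hsymm hc hn]
    · rw [m1, stateExp, modeG_pos_ground one_pos]
    · rw [m1, stateExp, modeG_pos_ground two_pos, smul_zero]
    · rw [m1, stateExp, modeG_pos_ground (by omega)]
    · rw [m0, m0, m1, hT, hS, stateExp, modeL_one_single hsymm hc]
      simp [SUSYStructure.mon, fockWeight, evenDegree, mul_div_cancel₀]
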